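/- An instance of $\mathsf{MinCKP}$ consists of $n\in\mathbb N$, vectors $c\in\mathbb Q^n$ and $p,q\in\mathbb Q_{\ge 0}^n$, and a rational $C>0$, and asks to minimize $c^\top x$ over $x\in\{0,1\}^n$ subject to $(p^\top x)^2+(q^\top x)^2\ge C$. Let $\mathsf{NLP}$ be its (non-convex) continuous relaxation, in which $x\in\{0,1\}^n$ is replaced by $x\in[0,1]^n$, and let $L$ be the length of the binary representation of the instance. Assume that the problem is feasible, i.e. $(\sum_i p_i)^2+(\sum_i q_i)^2\ge C$. For $\delta>0$, a rational vector $\hat x\in[0,1]^n$ is called $\delta$-optimal for $\mathsf{NLP}$ if $$c^\top\hat x\le c^\top x^*+\delta\qquad\text{and}\qquad (p^\top\hat x)^2+(q^\top\hat x)^2\ge C-\delta,$$ where $x^*$ is an optimal solution of $\mathsf{NLP}$. Theorem. There is an algorithm (a random access machine with logarithmic cost) which, for every feasible instance and every real $\delta>0$, given the instance and the integer $\lceil 1/\delta\rceil$ in binary, computes a $\delta$-optimal solution of $\mathsf{NLP}$ in time at most $K\,\bigl(L+\max\{0,\log\frac1\delta\}\bigr)^d$, with constants $K,d$ independent of the instance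 and of $\delta$; that is, in time $\mathrm{poly}(L,\log\frac1\delta)$. -/

import Mathlib

/-! ## A random access machine with logarithmic cost

Programs are while-programs over finitely many unbounded integer arrays, with indirect addressing
and the integer operations `+`, `-`, `*`, `/`.  Every operation is charged the bit lengths of the
numbers that it handles (the logarithmic cost criterion), so that running times are
polynomially related to those of Turing machines. -/

namespace RAM

/-- Length of the binary representation of an integer, with one bit for the sign. -/
def len (z : ℤ) : ℕ := Nat.size z.natAbs + 1

/-- A memory: `σ A i` is the integer stored in array `A` at index `i`. -/
abbrev Mem : Type := ℕ → ℤ → ℤ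

/-- Arithmetic expressions. `get A e` is the entry of array `A` at the index given by `e`. -/
inductive Expr : Type
  | const (z : ℤ) : Expr
  | get (A : ℕ) (e : Expr) : Expr
  | add (a b : Expr) : Expr
  | sub (a b : Expr) : Expr
  | mul (a b : Expr) : Expr
  | div (a b : Expr) : Expr

namespace Expr

/-- The value of an expression. -/
def eval (σ : Mem) : Expr → ℤ
  | const z => z
  | get A e => σ A (e.eval σ)
  | add a b => a.eval σ + b.eval σ
  | sub a b => a.eval σ - b.eval σ
  | mul a b => a.eval σ * b.eval σ
  | div a b => a.eval σ / b.eval σ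

/-- The cost of evaluating an expression. -/
def cost (σ : Mem) : Expr → ℕ
  | const z => len z
  | get A e => e.cost σ + len (e.eval σ) + len (σ A (e.eval σ))
  | add a b => a.cost σ + b.cost σ + len (a.eval σ) + len (b.eval σ)
  | sub a b => a.cost σ + b.cost σ + len (a.eval σ) + len (b.eval σ)
  | mul a b => a.cost σ + b.cost σ + len (a.eval σ) + len (b.eval σ)
  | div a b => a.cost σ + b.cost σ + len (a.eval σ) + len (b.eval σ)

end Expr

/-- Programs: `set A e f` stores the value of `f` in array `A` at the index given by `e`,
`branch g P Q` runs `P` if `g > 0` and `Q` otherwise, `loop g P` runs `P` as long as `g > 0`. -/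
inductive Prog : Type
  | skip : Prog
  | set (A : ℕ) (e f : Expr) : Prog
  | seq (P Q : Prog) : Prog
  | branch (g : Expr) (P Q : Prog) : Prog
  | loop (g : Expr) (P : Prog) : Prog

/-- The memory `σ` with the value `v` written to array `A` at index `i`. -/
def write (σ : Mem) (A : ℕ) (i v : ℤ) : Mem :=
  Function.update σ A (Function.update (σ A) i v)

/-- `Exec P σ t τ`: the program `P`, started in the memory `σ`, halts after time `t` in the
memory `τ`. -/
inductive Exec : Prog → Mem → ℕ → Mem → Prop
  | skip (σ : Mem) : Exec Prog.skip σ 1 σ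
  | set (σ : Mem) (A : ℕ) (e f : Expr) :
      Exec (Prog.set A e f) σ
        (e.cost σ + f.cost σ + len (e.eval σ) + len (f.eval σ))
        (write σ A (e.eval σ) (f.eval σ))
  | seq {P Q : Prog} {σ τ υ : Mem} {s t : ℕ} (hP : Exec P σ s τ) (hQ : Exec Q τ t υ) :
      Exec (Prog.seq P Q) σ (s + t) υ
  | branch_pos {g : Expr} {P Q : Prog} {σ τ : Mem} {t : ℕ} (hg : 0 < g.eval σ)
      (hP : Exec P σ t τ) : Exec (Prog.branch g P Q) σ (g.cost σ + len (g.eval σ) + t) τ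
  | branch_nonpos {g : Expr} {P Q : Prog} {σ τ : Mem} {t : ℕ} (hg : g.eval σ ≤ 0)
      (hQ : Exec Q σ t τ) : Exec (Prog.branch g P Q) σ (g.cost σ + len (g.eval σ) + t) τ
  | loop_done {g : Expr} {P : Prog} {σ : Mem} (hg : g.eval σ ≤ 0) :
      Exec (Prog.loop g P) σ (g.cost σ + len (g.eval σ)) σ
  | loop_step {g : Expr} {P : Prog} {σ τ υ : Mem} {s t : ℕ} (hg : 0 < g.eval σ)
      (hP : Exec P σ s τ) (hL : Exec (Prog.loop g P) τ t υ) :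
      Exec (Prog.loop g P) σ (g.cost σ + len (g.eval σ) + s + t) υ

end RAM

/-! ## The problem and its continuous relaxation -/

/-- An instance of `MinCKP`: minimize `cᵀ x` over `x ∈ {0,1}ⁿ` subject to
`(pᵀ x)² + (qᵀ x)² ≥ C`, with rational data, `p, q ≥ 0` and `C > 0`. -/
structure MinCKP where
  /-- the number of variables -/
  n : ℕ
  /-- the cost vector -/
  c : Fin n → ℚ
  /-- the first vector of the constraint -/
  p : Fin n → ℚ
  /-- the second vector of the constraint -/
  q : Fin n → ℚ
  /-- the demand -/
  C : ℚ
  p_nonneg : ∀ i, 0 ≤ p i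
  q_nonneg : ∀ i, 0 ≤ q i
  C_pos : 0 < C

namespace MinCKP

/-- The objective `cᵀ x`. -/
def objective (I : MinCKP) (x : Fin I.n → ℝ) : ℝ := ∑ i, (I.c i : ℝ) * x i

/-- The left-hand side `(pᵀ x)² + (qᵀ x)²` of the constraint. -/
def power (I : MinCKP) (x : Fin I.n → ℝ) : ℝ :=
  (∑ i, (I.p i : ℝ) * x i) ^ 2 + (∑ i, (I.q i : ℝ) * x i) ^ 2

/-- Feasibility for the relaxation `NLP`, where `x ∈ {0,1}ⁿ` is replaced by `x ∈ [0,1]ⁿ`. -/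
def IsFeasible (I : MinCKP) (x : Fin I.n → ℝ) : Prop :=
  (∀ i, x i ∈ Set.Icc (0 : ℝ) 1) ∧ (I.C : ℝ) ≤ I.power x

/-- Optimality for the relaxation `NLP`. -/
def IsOptimal (I : MinCKP) (x : Fin I.n → ℝ) : Prop :=
  I.IsFeasible x ∧ ∀ y, I.IsFeasible y → I.objective x ≤ I.objective y

/-- A rational vector `x ∈ [0,1]ⁿ` is `δ`-optimal for `NLP` if `cᵀ x ≤ cᵀ x* + δ` for an optimal
solution `x*` of `NLP`, and `(pᵀ x)² + (qᵀ x)² ≥ C - δ`. -/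
def IsDeltaOptimal (I : MinCKP) (δ : ℝ) (x : Fin I.n → ℚ) : Prop :=
  (∀ i, x i ∈ Set.Icc (0 : ℚ) 1) ∧
  (∃ xopt, I.IsOptimal xopt ∧ I.objective (fun i => (x i : ℝ)) ≤ I.objective xopt + δ) ∧
  (I.C : ℝ) - δ ≤ I.power (fun i => (x i : ℝ))

/-- Length of the binary representation of a rational number in lowest terms. -/
def ratLen (r : ℚ) : ℕ := RAM.len r.num + RAM.len r.den

/-- The length `L` of the binary representation of an instance. -/
def size (I : MinCKP) : ℕ :=
  ∑ i, (ratLen (I.c i) + ratLen (I.p i) + ratLen (I.q i)) + ratLen I.C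

/-- The array with entries `v 0, …, v (n - 1)` at the indices `0, …, n - 1` and `0` elsewhere. -/
def toArray {n : ℕ} (v : Fin n → ℤ) (i : ℤ) : ℤ :=
  if h : 0 ≤ i ∧ i.toNat < n then v ⟨i.toNat, h.2⟩ else 0

/-- The initial memory for the instance `I` and the accuracy `1 / N`: array `0` holds `n`, the
numerator and denominator of `C`, and `N`; arrays `1`, …, `6` hold the numerators and
denominators of the entries of `c`, `p`, `q`; all other entries are zero. -/
def input (I : MinCKP) (N : ℕ) : RAM.Mem
  | 0 => toArray ![(I.n : ℤ), I.C.num, (I.C.den : ℤ), (N : ℤ)]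
  | 1 => toArray fun i => (I.c i).num
  | 2 => toArray fun i => ((I.c i).den : ℤ)
  | 3 => toArray fun i => (I.p i).num
  | 4 => toArray fun i => ((I.p i).den : ℤ)
  | 5 => toArray fun i => (I.q i).num
  | 6 => toArray fun i => ((I.q i).den : ℤ)
  | _ => fun _ => 0

/-- The memory `σ` holds the rational vector `x` as output: numerators in array `7`, positive
denominators in array `8`. -/
def IsOutput (I : MinCKP) (σ : RAM.Mem) (x : Fin I.n → ℚ) : Prop :=
  ∀ i : Fin I.n, 0 < σ 8 (i : ℕ) ∧ x i = (σ 7 (i : ℕ) : ℚ) / (σ 8 (i : ℕ) : ℚ)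

end MinCKP

/-! The optimum of `NLP` is attained, by compactness, at some `x`.  Let `d = (pᵀ x, qᵀ x)`.  By the
Cauchy-Schwarz inequality every `y` in the box with `d ⬝ (pᵀ y, qᵀ y) ≥ |d|²` is feasible, so `x` may
be replaced by the greedy solution of a fractional knapsack problem with the weights
`d.1 * p i + d.2 * q i`: all items before some item `k` in the order by ratios of cost and weight,
and a fraction of `k` (`exists_prefix_of_refines`).

This order depends on the unknown `d`, but it changes only at the directions in which two items
have equal ratios.  If `d₁` and `d₂` are the critical directions around `d`, then every strict
comparison that holds at `d` holds at `d₁ + d₂` as well (`exists_roots_refine`), and ties at `d` may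
be broken arbitrarily.  Hence polynomially many candidates, each given by two pairs of items that
determine `d₁` and `d₂` and by the item `k`, include one that is at least as good as `x`
(`exists_prefix`).

The program clears denominators, goes through all candidates, finds the least feasible fraction of
item `k` on a grid by bisection, and keeps the cheapest candidate.  The grid is so fine that
rounding costs at most `1 / N ≤ δ` (`GridData.exists_candidate`), and since fractions are rounded up,
the result even satisfies the constraint exactly.

Running times are derived from the predicate `RAM.Halts`, which bounds the number of steps and the
lengths of all memory entries: a step costs at most a constant, given by the program, times the
bound for the lengths.  All numbers have length quadratic in the length of the input, so it remains
to count the rounds of the loops. -/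

/-! ### Running times of programs with bounded memory entries -/

namespace RAM

theorem one_le_len (z : ℤ) : 1 ≤ len z := Nat.le_add_left _ _

theorem len_mono {a b : ℤ} (h : |a| ≤ |b|) : len a ≤ len b := by
  have h' : a.natAbs ≤ b.natAbs := by
    rw [Int.abs_eq_natAbs, Int.abs_eq_natAbs] at h
    exact_mod_cast h
  exact Nat.add_le_add_right (Nat.size_le_size h') 1

theorem len_le_iff {z : ℤ} {k : ℕ} : len z ≤ k + 1 ↔ z.natAbs < 2 ^ k := by
  simp [len, Nat.size_le]

theorem len_natCast_le (n : ℕ) : len (n : ℤ) ≤ n + 1 := by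
  rw [len_le_iff]
  simpa using Nat.lt_two_pow_self

theorem natAbs_lt_two_pow_len (z : ℤ) : z.natAbs < 2 ^ (len z - 1) :=
  len_le_iff.1 (by have := one_le_len z; omega)

theorem len_add_le {a b : ℤ} {x y : ℕ} (ha : len a ≤ x) (hb : len b ≤ y) :
    len (a + b) ≤ x + y := by
  obtain ⟨x, rfl⟩ : ∃ k, x = k + 1 := ⟨x - 1, by have := one_le_len a; omega⟩
  obtain ⟨y, rfl⟩ : ∃ k, y = k + 1 := ⟨y - 1, by have := one_le_len b; omega⟩
  rw [len_le_iff] at ha hb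
  rw [show x + 1 + (y + 1) = (x + y + 1) + 1 by ring, len_le_iff]
  have h1 : 2 ^ x ≤ 2 ^ (x + y) := Nat.pow_le_pow_right two_pos (by omega)
  have h2 : 2 ^ y ≤ 2 ^ (x + y) := Nat.pow_le_pow_right two_pos (by omega)
  have h3 := Int.natAbs_add_le a b
  rw [pow_succ]
  omega

theorem len_neg (a : ℤ) : len (-a) = len a := by simp [len]

theorem len_sub_le {a b : ℤ} {x y : ℕ} (ha : len a ≤ x) (hb : len b ≤ y) :
    len (a - b) ≤ x + y := by
  rw [sub_eq_add_neg]
  exact len_add_le ha (by rwa [len_neg])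

theorem len_mul_le {a b : ℤ} {x y : ℕ} (ha : len a ≤ x) (hb : len b ≤ y) :
    len (a * b) ≤ x + y := by
  obtain ⟨x, rfl⟩ : ∃ k, x = k + 1 := ⟨x - 1, by have := one_le_len a; omega⟩
  obtain ⟨y, rfl⟩ : ∃ k, y = k + 1 := ⟨y - 1, by have := one_le_len b; omega⟩
  rw [len_le_iff] at ha hb
  refine le_trans ?_ (show (x + y) + 1 ≤ x + 1 + (y + 1) by omega)
  rw [len_le_iff, Int.natAbs_mul, pow_add]
  exact Nat.mul_lt_mul'' ha hb

theorem len_div_le {a : ℤ} (b : ℤ) {x : ℕ} (ha : len a ≤ x) : len (a / b) ≤ x :=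
  le_trans (Nat.add_le_add_right (Nat.size_le_size (Int.natAbs_ediv_le_natAbs a b)) 1) ha

theorem len_sum_le (f : ℕ → ℤ) (k : ℕ) :
    len (∑ i ∈ Finset.range k, f i) ≤ 1 + ∑ i ∈ Finset.range k, len (f i) := by
  induction k with
  | zero => simp [len]
  | succ k ih =>
    rw [Finset.sum_range_succ, Finset.sum_range_succ, ← add_assoc]
    exact len_add_le ih le_rfl

theorem len_prod_le (f : ℕ → ℤ) (k : ℕ) :
    len (∏ i ∈ Finset.range k, f i) ≤ 2 + ∑ i ∈ Finset.range k, len (f i) := by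
  induction k with
  | zero => simp [len]
  | succ k ih =>
    rw [Finset.prod_range_succ, Finset.sum_range_succ, ← add_assoc]
    exact len_mul_le ih le_rfl

/-- All entries of the memory have length at most `B`. -/
def Bounded (B : ℕ) (σ : Mem) : Prop := ∀ A i, len (σ A i) ≤ B

/-- A factor by which the length of the value of an expression may exceed the lengths of the
memory entries. -/
def Expr.width : Expr → ℕ
  | const z => len z
  | get _ _ => 1
  | add a b => a.width + b.width
  | sub a b => a.width + b.width
  | mul a b => a.width + b.width
  | div a _ => a.width

/-- The cost of evaluating an expression in a memory with entries of length at most `B`, in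
multiples of `B`. -/
def Expr.weight : Expr → ℕ
  | const z => len z
  | get _ e => e.weight + e.width + 1
  | add a b => a.weight + b.weight + a.width + b.width
  | sub a b => a.weight + b.weight + a.width + b.width
  | mul a b => a.weight + b.weight + a.width + b.width
  | div a b => a.weight + b.weight + a.width + b.width

variable {B : ℕ} {σ : Mem}

theorem Bounded.one_le (h : Bounded B σ) : 1 ≤ B := (one_le_len _).trans (h 0 0)

theorem Bounded.len_eval_le (h : Bounded B σ) (e : Expr) : len (e.eval σ) ≤ e.width * B := by
  induction e with
  | const z => exact Nat.le_mul_of_pos_right _ h.one_le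
  | get A e _ => rw [Expr.width, one_mul]; exact h A _
  | add a b iha ihb => rw [Expr.width, add_mul]; exact len_add_le iha ihb
  | sub a b iha ihb => rw [Expr.width, add_mul]; exact len_sub_le iha ihb
  | mul a b iha ihb => rw [Expr.width, add_mul]; exact len_mul_le iha ihb
  | div a b iha _ => exact len_div_le _ iha

theorem Bounded.cost_le (h : Bounded B σ) (e : Expr) : e.cost σ ≤ e.weight * B := by
  induction e with
  | const z => exact Nat.le_mul_of_pos_right _ h.one_le
  | get A e ih =>
    have h1 := h.len_eval_le e
    have h2 := h A (e.eval σ)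
    simp only [Expr.cost, Expr.weight, add_mul]
    omega
  | _ a b iha ihb =>
    have h1 := h.len_eval_le a
    have h2 := h.len_eval_le b
    simp only [Expr.cost, Expr.weight, add_mul]
    omega

/-- The cost of one step of a program in a memory with entries of length at most `B`, in
multiples of `B`. -/
def Prog.weight : Prog → ℕ
  | skip => 1
  | set _ e f => e.weight + f.weight + e.width + f.width
  | seq P Q => P.weight + Q.weight
  | branch g P Q => g.weight + g.width + P.weight + Q.weight
  | loop g P => g.weight + g.width + P.weight

/-- The arrays that a program writes to. -/
def Prog.targets : Prog → List ℕ
  | skip => []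
  | set A _ _ => [A]
  | seq P Q => P.targets ++ Q.targets
  | branch _ P Q => P.targets ++ Q.targets
  | loop _ P => P.targets

theorem write_of_ne (σ : Mem) {A A' : ℕ} (h : A' ≠ A) (i v : ℤ) : write σ A i v A' = σ A' := by
  simp [write, h]

theorem write_self (σ : Mem) (A : ℕ) (i v : ℤ) :
    write σ A i v A = Function.update (σ A) i v := by
  simp [write]

/-- A program leaves the arrays alone that it has no assignments to. -/
theorem Exec.frame {P : Prog} {σ τ : Mem} {t : ℕ} (h : Exec P σ t τ) {A : ℕ}
    (hA : A ∉ P.targets) : τ A = σ A := by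
  induction h with
  | skip => rfl
  | set σ A' e f => exact write_of_ne _ (by simpa [Prog.targets] using hA) _ _
  | seq _ _ ih1 ih2 =>
    simp only [Prog.targets, List.mem_append, not_or] at hA
    rw [ih2 hA.2, ih1 hA.1]
  | branch_pos _ _ ih | branch_nonpos _ _ ih =>
    simp only [Prog.targets, List.mem_append, not_or] at hA
    first | exact ih hA.1 | exact ih hA.2
  | loop_done => rfl
  | loop_step _ _ _ ih1 ih2 => rw [ih2 hA, ih1 hA]

/-- Total correctness with a bound on the running time and on the memory entries: from `σ`, the
program `P` halts in a memory with property `R` and with entries of length at most `B`, after at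
most `s` steps of cost `P.weight * B` each. -/
def Halts (B : ℕ) (P : Prog) (s : ℕ) (σ : Mem) (R : Mem → Prop) : Prop :=
  ∃ t τ, Exec P σ t τ ∧ t ≤ s * (P.weight * B) ∧ Bounded B τ ∧ R τ

namespace Halts

variable {P Q : Prog} {g : Expr} {s s' : ℕ} {R R' : Mem → Prop}

theorem mono (h : Halts B P s σ R) (hs : s ≤ s')
    (hR : ∀ τ, Bounded B τ → (∀ A, A ∉ P.targets → τ A = σ A) → R τ → R' τ) :
    Halts B P s' σ R' := by
  obtain ⟨t, τ, he, ht, hb, hr⟩ := h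
  exact ⟨t, τ, he, ht.trans (Nat.mul_le_mul_right _ hs), hb, hR τ hb (fun A hA => he.frame hA) hr⟩

theorem skip (hb : Bounded B σ) (h : R σ) : Halts B Prog.skip 1 σ R :=
  ⟨1, σ, Exec.skip σ, by simpa [Prog.weight] using hb.one_le, hb, h⟩

theorem set (hb : Bounded B σ) {A : ℕ} {e f : Expr} (hf : len (f.eval σ) ≤ B)
    (h : R (write σ A (e.eval σ) (f.eval σ))) : Halts B (Prog.set A e f) 1 σ R := by
  refine ⟨_, _, Exec.set σ A e f, ?_, ?_, h⟩
  · have h1 := hb.len_eval_le e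
    have h2 := hb.len_eval_le f
    have h3 := hb.cost_le e
    have h4 := hb.cost_le f
    simp only [Prog.weight, add_mul, one_mul]
    omega
  · intro A' i
    by_cases hA : A' = A
    · subst hA
      rw [write_self, Function.update_apply]
      split_ifs
      exacts [hf, hb _ _]
    · rw [write_of_ne _ hA]
      exact hb _ _

theorem seq (h : Halts B P s σ R)
    (h' : ∀ τ, Bounded B τ → (∀ A, A ∉ P.targets → τ A = σ A) → R τ → Halts B Q s' τ R') :
    Halts B (Prog.seq P Q) (s' + s) σ R' := by
  obtain ⟨t, τ, he, ht, hb, hr⟩ := h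
  obtain ⟨t', υ, he', ht', hb', hr'⟩ := h' τ hb (fun A hA => he.frame hA) hr
  refine ⟨_, υ, he.seq he', ?_, hb', hr'⟩
  have h1 : s * (P.weight * B) ≤ s * ((P.weight + Q.weight) * B) := by gcongr; omega
  have h2 : s' * (Q.weight * B) ≤ s' * ((P.weight + Q.weight) * B) := by gcongr; omega
  simp only [Prog.weight]
  rw [add_mul s' s]
  omega

theorem branch (hb : Bounded B σ) (hpos : 0 < g.eval σ → Halts B P s σ R)
    (hneg : g.eval σ ≤ 0 → Halts B Q s σ R) : Halts B (Prog.branch g P Q) (s + 1) σ R := by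
  have h1 := hb.len_eval_le g
  have h2 := hb.cost_le g
  rcases lt_or_ge 0 (g.eval σ) with hg | hg
  · obtain ⟨t, τ, he, ht, hb', hr⟩ := hpos hg
    refine ⟨_, τ, Exec.branch_pos hg he, ?_, hb', hr⟩
    have h3 : s * (P.weight * B) ≤ s * ((Prog.branch g P Q).weight * B) := by
      simp only [Prog.weight]; gcongr; omega
    have h4 : (g.weight + g.width) * B ≤ (Prog.branch g P Q).weight * B := by
      simp only [Prog.weight]; exact Nat.mul_le_mul_right _ (by omega)
    rw [add_mul] at h4
    rw [add_mul s 1]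
    omega
  · obtain ⟨t, τ, he, ht, hb', hr⟩ := hneg hg
    refine ⟨_, τ, Exec.branch_nonpos hg he, ?_, hb', hr⟩
    have h3 : s * (Q.weight * B) ≤ s * ((Prog.branch g P Q).weight * B) := by
      simp only [Prog.weight]; gcongr; omega
    have h4 : (g.weight + g.width) * B ≤ (Prog.branch g P Q).weight * B := by
      simp only [Prog.weight]; exact Nat.mul_le_mul_right _ (by omega)
    rw [add_mul] at h4
    rw [add_mul s 1]
    omega

/-- A loop with an invariant `J j`, where `j` bounds the number of rounds still to come. -/
theorem loop (J : ℕ → Mem → Prop) {T : ℕ} (hb : Bounded B σ) (h0 : J T σ)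
    (hstep : ∀ j τ, Bounded B τ → (∀ A, A ∉ P.targets → τ A = σ A) → J j τ → 0 < g.eval τ →
      ∃ i, j = i + 1 ∧ Halts B P s τ (J i)) :
    Halts B (Prog.loop g P) (T * (s + 1) + 1) σ (fun τ => g.eval τ ≤ 0 ∧ ∃ j, J j τ) := by
  suffices H : ∀ j τ, Bounded B τ → (∀ A, A ∉ P.targets → τ A = σ A) → J j τ →
      Halts B (Prog.loop g P) (j * (s + 1) + 1) τ (fun τ => g.eval τ ≤ 0 ∧ ∃ j, J j τ) from
    H T σ hb (fun _ _ => rfl) h0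
  intro j
  induction j with
  | zero =>
    intro τ hb hf hj
    have h1 := hb.len_eval_le g
    have h2 := hb.cost_le g
    rcases lt_or_ge 0 (g.eval τ) with hg | hg
    · obtain ⟨i, hi, _⟩ := hstep 0 τ hb hf hj hg
      omega
    · refine ⟨_, τ, Exec.loop_done hg, ?_, hb, hg, 0, hj⟩
      simp only [Prog.weight, add_mul]
      omega
  | succ j ih =>
    intro τ hb hf hj
    have h1 := hb.len_eval_le g
    have h2 := hb.cost_le g
    rcases lt_or_ge 0 (g.eval τ) with hg | hg
    · obtain ⟨i, hi, t, υ, he, ht, hb', hr⟩ := hstep _ τ hb hf hj hg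
      obtain rfl : i = j := by omega
      obtain ⟨t', ω, he', ht', hb'', hr'⟩ :=
        ih υ hb' (fun A hA => (he.frame hA).trans (hf A hA)) hr
      refine ⟨_, ω, Exec.loop_step hg he he', ?_, hb'', hr'⟩
      have h3 : s * (P.weight * B) ≤ s * ((Prog.loop g P).weight * B) := by
        simp only [Prog.weight]; gcongr; omega
      have h4 : (g.weight + g.width) * B ≤ (Prog.loop g P).weight * B := by
        simp only [Prog.weight]; exact Nat.mul_le_mul_right _ (by omega)
      rw [add_mul] at h4
      rw [show (i + 1) * (s + 1) + 1 = (i * (s + 1) + 1) + s + 1 by ring, add_mul, add_mul, one_mul]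
      omega
    · refine ⟨_, τ, Exec.loop_done hg, ?_, hb, hg, j + 1, hj⟩
      have h4 : (g.weight + g.width) * B ≤ (Prog.loop g P).weight * B := by
        simp only [Prog.weight]; exact Nat.mul_le_mul_right _ (by omega)
      rw [add_mul] at h4
      rw [add_mul _ 1]
      omega

/-- A loop with exactly `T` rounds; the invariant `J j` holds after `j` of them. -/
theorem forLoop (J : ℕ → Mem → Prop) (T : ℕ) (hb : Bounded B σ) (h0 : J 0 σ)
    (hg : ∀ j τ, (∀ A, A ∉ P.targets → τ A = σ A) → j ≤ T → J j τ → (0 < g.eval τ ↔ j < T))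
    (hstep : ∀ j τ, Bounded B τ → (∀ A, A ∉ P.targets → τ A = σ A) → j < T → J j τ →
      Halts B P s τ (J (j + 1))) :
    Halts B (Prog.loop g P) (T * (s + 1) + 1) σ (J T) := by
  have := loop (B := B) (P := P) (g := g) (s := s) (σ := σ) (T := T)
    (fun j τ => j ≤ T ∧ J (T - j) τ) hb (by simpa using h0) (by
      rintro j τ hb hf ⟨hjT, hJ⟩ hpos
      have hlt := (hg _ τ hf (by omega) hJ).1 hpos
      refine ⟨j - 1, by omega, (hstep _ τ hb hf hlt hJ).mono le_rfl fun υ _ _ hυ => ?_⟩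
      rw [show T - j + 1 = T - (j - 1) by omega] at hυ
      exact ⟨by omega, hυ⟩)
  refine this.mono le_rfl ?_
  rintro τ _ hf ⟨hle, j, hj, hJ⟩
  have h1 := (hg _ τ hf (by omega) hJ).not.1 (by omega)
  rwa [show T - j = T by omega] at hJ

end Halts

end RAM

/-! ### Greedy solutions -/

/-- The value at the direction `d` of the linear form `A d₁ + B d₂` given by `f = (A, B)`. -/
def formAt (f d : ℝ × ℝ) : ℝ := f.1 * d.1 + f.2 * d.2

/-- The zero of the linear form `f`, up to a factor. -/
def formRoot (f : ℝ × ℝ) : ℝ × ℝ := (f.2, -f.1)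

/-- For a finite set of linear forms, the sum of the two roots in the quadrant next to a direction
`d`, one on each side, satisfies every strict sign condition that holds at `d`: no form changes its
sign between `d` and one of these roots. -/
theorem exists_roots_refine (F : Finset (ℝ × ℝ)) (hneg : ∀ f ∈ F, -f ∈ F)
    (h1 : ((0 : ℝ), (1 : ℝ)) ∈ F) (h2 : ((1 : ℝ), (0 : ℝ)) ∈ F) (d : ℝ × ℝ)
    (hd1 : 0 ≤ d.1) (hd2 : 0 ≤ d.2) (hd : 0 < d.1 + d.2) :
    ∃ f₁ ∈ F, ∃ f₂ ∈ F, ∀ g ∈ F, 0 < formAt g d →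
      0 < formAt g (formRoot f₁ + formRoot f₂) := by
  classical
  -- `u` increases with the angle of the root
  let u : ℝ × ℝ → ℝ := fun f => -f.1 / (f.2 - f.1)
  have hu : ∀ f g : ℝ × ℝ, 0 < f.2 - f.1 → 0 < g.2 - g.1 → u f ≤ u g →
      f.2 * g.1 ≤ f.1 * g.2 := by
    intro f g hf hg h
    simp only [u] at h
    rw [div_le_div_iff₀ hf hg] at h
    nlinarith
  let Q : Finset (ℝ × ℝ) := F.filter fun f => f.1 ≤ 0 ∧ 0 ≤ f.2 ∧ 0 < f.2 - f.1
  obtain ⟨f₁, hf₁, hmax⟩ := (Q.filter fun f => 0 ≤ formAt f d).exists_max_image u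
    ⟨(0, 1), by simp [Q, h1, formAt, hd2]⟩
  obtain ⟨f₂, hf₂, hmin⟩ := (Q.filter fun f => formAt f d ≤ 0).exists_min_image u
    ⟨-(1, 0), by simp only [Q, Finset.mem_filter]; exact ⟨⟨hneg _ h2, by simp⟩, by simp [formAt, hd1]⟩⟩
  simp only [Q, Finset.mem_filter] at hf₁ hf₂ hmax hmin
  obtain ⟨⟨hF₁, ha₁, hb₁, hs₁⟩, hp₁⟩ := hf₁
  obtain ⟨⟨hF₂, ha₂, hb₂, hs₂⟩, hp₂⟩ := hf₂
  refine ⟨f₁, hF₁, f₂, hF₂, fun g hg hgd => ?_⟩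
  obtain ⟨A, B⟩ := g
  obtain ⟨a₁, b₁⟩ := f₁
  obtain ⟨a₂, b₂⟩ := f₂
  obtain ⟨x, y⟩ := d
  simp only [formAt, formRoot, Prod.mk_add_mk] at *
  have hr₁ : 0 ≤ A * b₁ - B * a₁ := by
    by_contra! hlt
    -- the form is negative at the root of `f₁` and positive at `d`, so its root lies strictly
    -- between them, against the choice of `f₁`; the combinations below are multiples of this root
    have e1 : (A * x + B * y) * b₁ - (A * b₁ - B * a₁) * x = (a₁ * x + b₁ * y) * B := by ring
    have e2 : (A * x + B * y) * (-a₁) - (A * b₁ - B * a₁) * y = (a₁ * x + b₁ * y) * (-A) := by ring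
    have hpos : 0 < a₁ * x + b₁ * y := by
      refine lt_of_le_of_ne hp₁ fun h0 => ?_
      rw [← h0] at e1 e2
      nlinarith [mul_pos hgd hs₁, mul_nonneg (neg_nonneg.2 hlt.le) hd1,
        mul_nonneg (neg_nonneg.2 hlt.le) hd2]
    have hB : 0 ≤ B := nonneg_of_mul_nonneg_right (by
      rw [← e1]; nlinarith [mul_nonneg hgd.le hb₁, mul_nonneg (neg_nonneg.2 hlt.le) hd1]) hpos
    have hA : 0 ≤ -A := nonneg_of_mul_nonneg_right (by
      rw [← e2]; nlinarith [mul_nonneg hgd.le (neg_nonneg.2 ha₁),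
        mul_nonneg (neg_nonneg.2 hlt.le) hd2]) hpos
    have hAB : 0 < B - A := by
      refine lt_of_le_of_ne (by linarith) fun h0 => ?_
      have hB0 : B = 0 := by linarith
      have hA0 : A = 0 := by linarith
      simp [hA0, hB0] at hgd
    have := hu (A, B) (a₁, b₁) hAB hs₁
      (hmax (A, B) ⟨⟨hg, by simpa using hA, hB, hAB⟩, hgd.le⟩)
    simp only at this
    linarith
  have hr₂ : 0 ≤ A * b₂ - B * a₂ := by
    by_contra! hlt
    -- the same on the other side of `d`, for the form `-(A, B)`
    have e1 : (A * x + B * y) * b₂ - (A * b₂ - B * a₂) * x = (-(a₂ * x + b₂ * y)) * (-B) := by ring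
    have e2 : (A * x + B * y) * (-a₂) - (A * b₂ - B * a₂) * y = (-(a₂ * x + b₂ * y)) * A := by ring
    have hpos : 0 < -(a₂ * x + b₂ * y) := by
      refine lt_of_le_of_ne (by linarith) fun h0 => ?_
      rw [← h0] at e1 e2
      nlinarith [mul_pos hgd hs₂, mul_nonneg (neg_nonneg.2 hlt.le) hd1,
        mul_nonneg (neg_nonneg.2 hlt.le) hd2]
    have hB : 0 ≤ -B := nonneg_of_mul_nonneg_right (by
      rw [← e1]; nlinarith [mul_nonneg hgd.le hb₂, mul_nonneg (neg_nonneg.2 hlt.le) hd1]) hpos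
    have hA : 0 ≤ A := nonneg_of_mul_nonneg_right (by
      rw [← e2]; nlinarith [mul_nonneg hgd.le (neg_nonneg.2 ha₂),
        mul_nonneg (neg_nonneg.2 hlt.le) hd2]) hpos
    have hAB : 0 < -B - -A := by
      refine lt_of_le_of_ne (by linarith) fun h0 => ?_
      have hB0 : B = 0 := by linarith
      have hA0 : A = 0 := by linarith
      simp [hA0, hB0] at hgd
    have := hu (a₂, b₂) (-A, -B) hs₂ hAB
      (hmin (-A, -B) ⟨⟨hneg _ hg, by simpa using hA, hB, hAB⟩, by simp only; linarith⟩)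
    simp only at this
    linarith
  have hsum : A * (b₁ + b₂) + B * (-a₁ + -a₂) = (A * b₁ - B * a₁) + (A * b₂ - B * a₂) := by ring
  rw [hsum]
  refine lt_of_le_of_ne (add_nonneg hr₁ hr₂) fun h0 => ?_
  -- if the form vanished at both roots, these would be parallel to each other and to `d`
  have z1 : A * b₁ - B * a₁ = 0 := by linarith
  have z2 : A * b₂ - B * a₂ = 0 := by linarith
  have k1 : (A * x + B * y) * b₁ = (a₁ * x + b₁ * y) * B := by linear_combination x * z1
  have k2 : (A * x + B * y) * (-a₁) = (a₁ * x + b₁ * y) * (-A) := by linear_combination y * z1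
  have k3 : (A * x + B * y) * b₂ = (a₂ * x + b₂ * y) * B := by linear_combination x * z2
  have k4 : (A * x + B * y) * (-a₂) = (a₂ * x + b₂ * y) * (-A) := by linear_combination y * z2
  have k5 : 0 < (a₁ * x + b₁ * y) * (B - A) := by nlinarith [mul_pos hgd hs₁]
  have k6 : 0 < (a₂ * x + b₂ * y) * (B - A) := by nlinarith [mul_pos hgd hs₂]
  have k7 : 0 < B - A := lt_of_not_ge fun h =>
    absurd k5 (not_lt.2 (mul_nonpos_of_nonneg_of_nonpos hp₁ h))
  nlinarith [mul_nonneg (neg_nonneg.2 hp₂) k7.le]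

section Greedy

variable (c p q : ℕ → ℝ)

/-- The weight of item `i` in direction `d`, as an item of a knapsack problem. -/
def dirWeight (d : ℝ × ℝ) (i : ℕ) : ℝ := d.1 * p i + d.2 * q i

/-- Positive if item `i` has a smaller ratio of cost and weight in direction `d` than item `k`. -/
def dirGap (d : ℝ × ℝ) (i k : ℕ) : ℝ :=
  c k * dirWeight p q d i - c i * dirWeight p q d k

/-- Item `i` comes before item `k` in the order by ratios of cost and weight in direction `d`,
where ties are broken by the index. -/
def Precedes (d : ℝ × ℝ) (i k : ℕ) : Prop :=
  0 < dirGap c p q d i k ∨ dirGap c p q d i k = 0 ∧ i < k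

/-- The direction in which the items `i` and `j` have the same ratio of cost and weight. -/
def critDir (i j : ℕ) : ℝ × ℝ := (c i * q j - c j * q i, c j * p i - c i * p j)

theorem precedes_iff_toLex {d : ℝ × ℝ} {i k : ℕ} (hi : 0 < dirWeight p q d i)
    (hk : 0 < dirWeight p q d k) :
    Precedes c p q d i k ↔
      toLex (c i / dirWeight p q d i, i) < toLex (c k / dirWeight p q d k, k) := by
  rw [Prod.Lex.toLex_lt_toLex, div_lt_div_iff₀ hi hk, div_eq_div_iff hi.ne' hk.ne']
  simp only [Precedes, dirGap, sub_pos, sub_eq_zero]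
  constructor
  · rintro (h | ⟨h, h'⟩)
    exacts [Or.inl h, Or.inr ⟨h.symm, h'⟩]
  · rintro (h | ⟨h, h'⟩)
    exacts [Or.inl h, Or.inr ⟨h.symm, h'⟩]

open Classical in
/-- If the order in direction `e` refines the one in direction `d = (pᵀ x, qᵀ x)`, then a prefix
of it, with one fractional item, is at least as good as `x`. -/
theorem exists_prefix_of_refines (n : ℕ) (hp : ∀ i < n, 0 ≤ p i) (hq : ∀ i < n, 0 ≤ q i)
    (x : ℕ → ℝ) (hx0 : ∀ i < n, 0 ≤ x i) (hx1 : ∀ i < n, x i ≤ 1) (d e : ℝ × ℝ)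
    (hd1 : d.1 = ∑ i ∈ Finset.range n, p i * x i) (hd2 : d.2 = ∑ i ∈ Finset.range n, q i * x i)
    (hd : 0 < d.1 ^ 2 + d.2 ^ 2)
    (hgap : ∀ i < n, ∀ k < n, 0 < dirGap c p q d i k → 0 < dirGap c p q e i k)
    (hw : ∀ i < n, 0 < dirWeight p q d i → 0 < dirWeight p q e i) :
    ∃ k < n, ∃ l : ℝ, 0 ≤ l ∧ l ≤ 1 ∧
      (∑ i ∈ (Finset.range n).filter (fun i => Precedes c p q e i k), c i) + l * c k ≤
        ∑ i ∈ Finset.range n, c i * x i ∧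
      d.1 ^ 2 + d.2 ^ 2 ≤
        ((∑ i ∈ (Finset.range n).filter (fun i => Precedes c p q e i k), p i) + l * p k) ^ 2 +
        ((∑ i ∈ (Finset.range n).filter (fun i => Precedes c p q e i k), q i) + l * q k) ^ 2 := by
  have hd10 : 0 ≤ d.1 := hd1 ▸ Finset.sum_nonneg fun i hi =>
    mul_nonneg (hp i (Finset.mem_range.1 hi)) (hx0 i (Finset.mem_range.1 hi))
  have hd20 : 0 ≤ d.2 := hd2 ▸ Finset.sum_nonneg fun i hi =>
    mul_nonneg (hq i (Finset.mem_range.1 hi)) (hx0 i (Finset.mem_range.1 hi))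
  set w := dirWeight p q d with hwdef
  have hw0 : ∀ i < n, 0 ≤ w i := fun i hi =>
    add_nonneg (mul_nonneg hd10 (hp i hi)) (mul_nonneg hd20 (hq i hi))
  have hwx : ∑ i ∈ Finset.range n, w i * x i = d.1 ^ 2 + d.2 ^ 2 := by
    calc ∑ i ∈ Finset.range n, w i * x i
        = d.1 * ∑ i ∈ Finset.range n, p i * x i + d.2 * ∑ i ∈ Finset.range n, q i * x i := by
          rw [Finset.mul_sum, Finset.mul_sum, ← Finset.sum_add_distrib]
          exact Finset.sum_congr rfl fun i _ => by simp only [hwdef, dirWeight]; ring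
      _ = _ := by rw [← hd1, ← hd2]; ring
  set Wx := d.1 ^ 2 + d.2 ^ 2 with hWx
  let K := (Finset.range n).filter fun i => 0 < w i
  have hK : ∀ {i}, i ∈ K ↔ i < n ∧ 0 < w i := by simp [K]
  let key : ℕ → ℝ ×ₗ ℕ := fun i => toLex (c i / dirWeight p q e i, i)
  have hkey : ∀ i ∈ K, ∀ k ∈ K, (Precedes c p q e i k ↔ key i < key k) := fun i hi k hk =>
    precedes_iff_toLex c p q (hw i (hK.1 hi).1 (hK.1 hi).2) (hw k (hK.1 hk).1 (hK.1 hk).2)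
  have hkeyinj : ∀ i k, key i = key k → i = k := fun i k h =>
    (Prod.mk.inj (toLex_inj.1 h)).2
  let S : ℕ → Finset ℕ := fun k => (Finset.range n).filter fun i => Precedes c p q e i k
  have hkS : ∀ k, k ∉ S k := by
    intro k hk
    simp [S, Precedes, dirGap] at hk
  -- only the items of positive weight matter in a weight
  have hWS : ∀ k, ∑ i ∈ S k, w i = ∑ i ∈ K.filter (fun i => Precedes c p q e i k), w i := by
    intro k
    symm
    apply Finset.sum_subset
    · intro i hi
      simp only [Finset.mem_filter, hK] at hi
      simp only [S, Finset.mem_filter, Finset.mem_range]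
      exact ⟨hi.1.1, hi.2⟩
    · intro i hi hi'
      simp only [S, Finset.mem_filter, Finset.mem_range] at hi
      by_contra h0
      exact hi' (Finset.mem_filter.2 ⟨hK.2 ⟨hi.1, lt_of_le_of_ne (hw0 i hi.1) (Ne.symm h0)⟩, hi.2⟩)
  have hKsum : ∑ i ∈ K, w i = ∑ i ∈ Finset.range n, w i := by
    apply Finset.sum_subset (Finset.filter_subset _ _)
    intro i hi hi'
    by_contra h0
    exact hi' (hK.2 ⟨Finset.mem_range.1 hi,
      lt_of_le_of_ne (hw0 i (Finset.mem_range.1 hi)) (Ne.symm h0)⟩)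
  have hle : Wx ≤ ∑ i ∈ K, w i := by
    rw [hKsum, ← hwx]
    exact Finset.sum_le_sum fun i hi => mul_le_of_le_one_right (hw0 i (Finset.mem_range.1 hi))
      (hx1 i (Finset.mem_range.1 hi))
  have hKne : K.Nonempty := by
    by_contra h
    rw [Finset.not_nonempty_iff_eq_empty] at h
    rw [h, Finset.sum_empty] at hle
    linarith
  obtain ⟨k₀, hk₀, hk₀max⟩ := K.exists_max_image key hKne
  have hcover : ∀ T : Finset ℕ, T ⊆ K → ∀ k ∈ T, (∀ i ∈ T, key i ≤ key k) →
      ∑ i ∈ T, w i ≤ ∑ i ∈ S k, w i + w k := by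
    intro T hT k hk hmax
    rw [hWS, ← Finset.sum_erase_add T w hk]
    refine add_le_add (Finset.sum_le_sum_of_subset_of_nonneg ?_ ?_) le_rfl
    · intro i hi
      obtain ⟨hik, hi⟩ := Finset.mem_erase.1 hi
      refine Finset.mem_filter.2 ⟨hT hi, (hkey i (hT hi) k (hT hk)).2 ?_⟩
      exact lt_of_le_of_ne (hmax i hi) fun h => hik (hkeyinj _ _ h)
    · intro i hi _
      exact (hK.1 (Finset.mem_filter.1 hi).1).2.le
  -- `k` is the first item with which the prefix reaches the weight of `x`
  obtain ⟨k, hk, hkmin⟩ := (K.filter fun k => Wx ≤ ∑ i ∈ S k, w i + w k).exists_min_image key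
    ⟨k₀, Finset.mem_filter.2 ⟨hk₀, hle.trans (hcover K subset_rfl k₀ hk₀ hk₀max)⟩⟩
  obtain ⟨hkK, hkW⟩ := Finset.mem_filter.1 hk
  obtain ⟨hkn, hwk⟩ := hK.1 hkK
  have hlt : ∑ i ∈ S k, w i < Wx := by
    rw [hWS]
    rcases (K.filter (fun i => Precedes c p q e i k)).eq_empty_or_nonempty with h | h
    · rw [h, Finset.sum_empty]
      exact hd
    · obtain ⟨k', hk', hk'max⟩ := Finset.exists_max_image _ key h
      refine lt_of_le_of_lt (hcover _ (Finset.filter_subset _ _) k' hk' hk'max) ?_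
      by_contra! hge
      obtain ⟨hk'K, hprec⟩ := Finset.mem_filter.1 hk'
      exact absurd (hkmin k' (Finset.mem_filter.2 ⟨hk'K, hge⟩))
        (not_le.2 ((hkey k' hk'K k hkK).1 hprec))
  let l : ℝ := (Wx - ∑ i ∈ S k, w i) / w k
  have hl0 : 0 ≤ l := div_nonneg (by linarith) hwk.le
  have hl1 : l ≤ 1 := (div_le_one hwk).2 (by linarith)
  have hlw : l * w k = Wx - ∑ i ∈ S k, w i := div_mul_cancel₀ _ hwk.ne'
  refine ⟨k, hkn, l, hl0, hl1, ?_, ?_⟩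
  · -- `y` is the prefix with the fraction `l` of item `k`; `r = c k / w k` is a dual multiplier
    let y : ℕ → ℝ := fun i => if i ∈ S k then 1 else if i = k then l else 0
    have hy : ∀ f : ℕ → ℝ, ∑ i ∈ Finset.range n, f i * y i = ∑ i ∈ S k, f i + l * f k := by
      intro f
      have : ∀ i, f i * y i = (if i ∈ S k then f i else 0) + (if i = k then l * f k else 0) := by
        intro i
        by_cases h1 : i ∈ S k
        · have : i ≠ k := fun h => hkS k (h ▸ h1)
          simp [y, h1, this]
        · by_cases h2 : i = k
          · subst h2
            simp [y, h1, mul_comm]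
          · simp [y, h1, h2]
      simp only [this, Finset.sum_add_distrib, Finset.sum_ite_mem, Finset.sum_ite_eq',
        Finset.mem_range, hkn, if_true]
      congr 2
      exact Finset.inter_eq_right.2 (Finset.filter_subset _ _)
    have hterm : ∀ i ∈ Finset.range n,
        0 ≤ (c i * w k - c k * w i) * (x i - y i) := by
      intro i hi
      have hin := Finset.mem_range.1 hi
      by_cases h1 : i ∈ S k
      · have hyi : y i = 1 := by simp [y, h1]
        have hpr := (Finset.mem_filter.1 h1).2
        have : c i * w k - c k * w i ≤ 0 := by
          by_contra! h
          have h' := hgap k hkn i hin (by simpa [dirGap] using h)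
          rcases hpr with h2 | ⟨h2, _⟩ <;> simp only [dirGap] at h2 h' <;> linarith
        exact mul_nonneg_of_nonpos_of_nonpos this (by rw [hyi]; linarith [hx1 i hin])
      · by_cases h2 : i = k
        · subst h2
          simp
        · have hyi : y i = 0 := by simp [y, h1, h2]
          have : 0 ≤ c i * w k - c k * w i := by
            by_contra! h
            have h' := hgap i hin k hkn (by simp only [dirGap]; linarith)
            exact h1 (Finset.mem_filter.2 ⟨hi, Or.inl h'⟩)
          exact mul_nonneg this (by rw [hyi]; linarith [hx0 i hin])
    have hsum := Finset.sum_nonneg hterm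
    have hexp : ∑ i ∈ Finset.range n, (c i * w k - c k * w i) * (x i - y i) =
        w k * (∑ i ∈ Finset.range n, c i * x i - ∑ i ∈ Finset.range n, c i * y i) -
        c k * (∑ i ∈ Finset.range n, w i * x i - ∑ i ∈ Finset.range n, w i * y i) := by
      simp only [Finset.mul_sum, ← Finset.sum_sub_distrib]
      exact Finset.sum_congr rfl fun i _ => by ring
    have hwy := hy w
    rw [hexp, hwy, hwx, hlw, hy c] at hsum
    have : 0 ≤ ∑ i ∈ Finset.range n, c i * x i - (∑ i ∈ S k, c i + l * c k) :=
      nonneg_of_mul_nonneg_right (by linarith [hsum]) hwk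
    linarith
  · -- Cauchy-Schwarz
    set a := ∑ i ∈ S k, p i + l * p k with ha
    set b := ∑ i ∈ S k, q i + l * q k with hb
    have hab : d.1 * a + d.2 * b = Wx := by
      have : ∑ i ∈ S k, w i = d.1 * ∑ i ∈ S k, p i + d.2 * ∑ i ∈ S k, q i := by
        rw [Finset.mul_sum, Finset.mul_sum, ← Finset.sum_add_distrib]
        rfl
      have hwk' : w k = d.1 * p k + d.2 * q k := rfl
      rw [this, hwk'] at hlw
      rw [ha, hb]
      linarith
    change Wx ≤ a ^ 2 + b ^ 2
    nlinarith [sq_nonneg (a - d.1), sq_nonneg (b - d.2)]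

open Classical in
/-- A polynomial number of orders and prefixes is enough to be at least as good as any `x`; the
items `n`, `n + 1`, `n + 2` only serve to make the axes and the weights available as forms. -/
theorem exists_prefix (n : ℕ) (hp : ∀ i < n, 0 ≤ p i) (hq : ∀ i < n, 0 ≤ q i)
    (hcn : c n = 1) (hpn : p n = 0) (hqn : q n = 0)
    (hcn1 : c (n + 1) = 0) (hpn1 : p (n + 1) = 1) (hqn1 : q (n + 1) = 0)
    (hcn2 : c (n + 2) = 0) (hpn2 : p (n + 2) = 0) (hqn2 : q (n + 2) = 1)
    (x : ℕ → ℝ) (hx0 : ∀ i < n, 0 ≤ x i) (hx1 : ∀ i < n, x i ≤ 1)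
    (hpos : 0 < (∑ i ∈ Finset.range n, p i * x i) ^ 2 + (∑ i ∈ Finset.range n, q i * x i) ^ 2) :
    ∃ i₁ < n + 3, ∃ j₁ < n + 3, ∃ i₂ < n + 3, ∃ j₂ < n + 3, ∃ k < n, ∃ l : ℝ, 0 ≤ l ∧ l ≤ 1 ∧
      ∀ S, S = (Finset.range n).filter (fun i =>
          Precedes c p q (critDir c p q i₁ j₁ + critDir c p q i₂ j₂) i k) →
        (∑ i ∈ S, c i) + l * c k ≤ ∑ i ∈ Finset.range n, c i * x i ∧
        (∑ i ∈ Finset.range n, p i * x i) ^ 2 + (∑ i ∈ Finset.range n, q i * x i) ^ 2 ≤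
          ((∑ i ∈ S, p i) + l * p k) ^ 2 + ((∑ i ∈ S, q i) + l * q k) ^ 2 := by
  let form : ℕ × ℕ → ℝ × ℝ := fun a => (c a.1 * p a.2 - c a.2 * p a.1, c a.1 * q a.2 - c a.2 * q a.1)
  let F : Finset (ℝ × ℝ) := (Finset.range (n + 3) ×ˢ Finset.range (n + 3)).image form
  have hmem : ∀ i < n + 3, ∀ j < n + 3, form (i, j) ∈ F := fun i hi j hj =>
    Finset.mem_image_of_mem _ (by simp [hi, hj])
  have hF : ∀ f ∈ F, ∃ i < n + 3, ∃ j < n + 3, form (i, j) = f := by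
    intro f hf
    obtain ⟨⟨i, j⟩, hij, rfl⟩ := Finset.mem_image.1 hf
    simp only [Finset.mem_product, Finset.mem_range] at hij
    exact ⟨i, hij.1, j, hij.2, rfl⟩
  have hform : ∀ i k d, formAt (form (k, i)) d = dirGap c p q d i k := by
    intro i k d
    simp only [form, formAt, dirGap, dirWeight]
    ring
  have hroot : ∀ i j, formRoot (form (i, j)) = critDir c p q i j := by
    intro i j
    simp [form, formRoot, critDir]
  set d : ℝ × ℝ := (∑ i ∈ Finset.range n, p i * x i, ∑ i ∈ Finset.range n, q i * x i) with hddef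
  have hd10 : 0 ≤ d.1 := Finset.sum_nonneg fun i hi =>
    mul_nonneg (hp i (Finset.mem_range.1 hi)) (hx0 i (Finset.mem_range.1 hi))
  have hd20 : 0 ≤ d.2 := Finset.sum_nonneg fun i hi =>
    mul_nonneg (hq i (Finset.mem_range.1 hi)) (hx0 i (Finset.mem_range.1 hi))
  have hdpos : 0 < d.1 + d.2 := by
    by_contra! h
    have e1 : d.1 = 0 := by linarith
    have e2 : d.2 = 0 := by linarith
    change 0 < d.1 ^ 2 + d.2 ^ 2 at hpos
    simp [e1, e2] at hpos
  obtain ⟨f₁, hf₁, f₂, hf₂, H⟩ := exists_roots_refine F (by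
      intro f hf
      obtain ⟨i, hi, j, hj, rfl⟩ := hF f hf
      convert hmem j hj i hi using 1
      simp [form])
    (by convert hmem n (by omega) (n + 2) (by omega) using 1; simp [form, hcn, hpn2, hqn2, hcn2])
    (by convert hmem n (by omega) (n + 1) (by omega) using 1; simp [form, hcn, hpn1, hqn1, hcn1])
    d hd10 hd20 hdpos
  obtain ⟨i₁, hi₁, j₁, hj₁, rfl⟩ := hF f₁ hf₁
  obtain ⟨i₂, hi₂, j₂, hj₂, rfl⟩ := hF f₂ hf₂
  rw [hroot, hroot] at H
  have hnw : ∀ i d, dirGap c p q d i n = dirWeight p q d i := by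
    intro i d
    simp [dirGap, dirWeight, hcn, hpn, hqn]
  obtain ⟨k, hk, l, hl0, hl1, h1, h2⟩ := exists_prefix_of_refines c p q n hp hq x hx0 hx1 d
    (critDir c p q i₁ j₁ + critDir c p q i₂ j₂) rfl rfl hpos
    (fun i hi k hk h => by
      rw [← hform] at h ⊢
      exact H _ (hmem k (by omega) i (by omega)) h)
    (fun i hi h => by
      rw [← hnw, ← hform] at h ⊢
      exact H _ (hmem n (by omega) i (by omega)) h)
  refine ⟨i₁, hi₁, j₁, hj₁, i₂, hi₂, j₂, hj₂, k, hk, l, hl0, hl1, ?_⟩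
  rintro S rfl
  exact ⟨h1, h2⟩

end Greedy

/-! ### The search program -/

namespace RAM

instance : Add Expr := ⟨Expr.add⟩
instance : Sub Expr := ⟨Expr.sub⟩
instance : Mul Expr := ⟨Expr.mul⟩
instance : Div Expr := ⟨Expr.div⟩

/-- The integer stored at index `0` of an array. -/
def reg (A : ℕ) : Expr := Expr.get A (Expr.const 0)

/-- Assignment to the entry at index `0` of an array. -/
def setReg (A : ℕ) (f : Expr) : Prog := Prog.set A (Expr.const 0) f

infixr:50 " ;; " => Prog.seq

section Eval

variable (σ : Mem) (a b : Expr) (A : ℕ) (z : ℤ)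

theorem eval_add : (a + b).eval σ = a.eval σ + b.eval σ := rfl
theorem eval_sub : (a - b).eval σ = a.eval σ - b.eval σ := rfl
theorem eval_mul : (a * b).eval σ = a.eval σ * b.eval σ := rfl
theorem eval_div : (a / b).eval σ = a.eval σ / b.eval σ := rfl
theorem eval_const : (Expr.const z).eval σ = z := rfl
theorem eval_get : (Expr.get A a).eval σ = σ A (a.eval σ) := rfl
theorem eval_reg : (reg A).eval σ = σ A 0 := rfl

end Eval

theorem write_apply (σ : Mem) (A A' : ℕ) (i i' v : ℤ) :
    write σ A i v A' i' = if A' = A ∧ i' = i then v else σ A' i' := by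
  by_cases hA : A' = A
  · subst hA
    simp [write_self, Function.update_apply]
  · simp [write_of_ne _ hA, hA]

namespace Halts

variable {B : ℕ} {σ : Mem} {Q : Prog} {s : ℕ} {R : Mem → Prop}

theorem setThen (hb : Bounded B σ) {A : ℕ} {e f : Expr} (i v : ℤ) (hi : e.eval σ = i)
    (hv : f.eval σ = v) (hl : len v ≤ B)
    (h : Bounded B (write σ A i v) → Halts B Q s (write σ A i v) R) :
    Halts B (Prog.set A e f ;; Q) (s + 1) σ R := by
  subst hi hv
  exact (Halts.set (R := fun τ => τ = write σ A (e.eval σ) (f.eval σ)) hb hl rfl).seq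
    fun τ hb _ hτ => by subst hτ; exact h hb

theorem setLast (hb : Bounded B σ) {A : ℕ} {e f : Expr} (i v : ℤ) (hi : e.eval σ = i)
    (hv : f.eval σ = v) (hl : len v ≤ B) (h : R (write σ A i v)) :
    Halts B (Prog.set A e f) 1 σ R := by
  subst hi hv
  exact Halts.set hb hl h

theorem regThen (hb : Bounded B σ) {A : ℕ} {f : Expr} (v : ℤ) (hv : f.eval σ = v)
    (hl : len v ≤ B) (h : Bounded B (write σ A 0 v) → Halts B Q s (write σ A 0 v) R) :
    Halts B (setReg A f ;; Q) (s + 1) σ R :=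
  setThen hb 0 v rfl hv hl h

theorem regLast (hb : Bounded B σ) {A : ℕ} {f : Expr} (v : ℤ) (hv : f.eval σ = v)
    (hl : len v ≤ B) (h : R (write σ A 0 v)) : Halts B (setReg A f) 1 σ R :=
  setLast hb 0 v rfl hv hl h

end Halts

end RAM

open RAM

/-- Integer data on which the search program works: the number of items, the scaled integer
vectors, the scale, a bound for all sums of the entries, the number of grid steps for the
fractional item, and the numerator and denominator of the demand. -/
structure GridData where
  /-- the number of items -/
  n : ℕ
  /-- the scaled costs -/
  c : ℕ → ℤ
  /-- the scaled first vector -/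
  p : ℕ → ℤ
  /-- the scaled second vector -/
  q : ℕ → ℤ
  /-- the scale -/
  D : ℤ
  /-- a bound for the sums of absolute values of entries -/
  M : ℤ
  /-- the number of grid steps -/
  G : ℤ
  /-- the numerator of the demand -/
  Cn : ℤ
  /-- the denominator of the demand -/
  Cd : ℤ

namespace GridData

variable (d : GridData)

/-- Signs and sizes of the data: all numbers have length at most `b`. -/
structure Tame (b : ℕ) : Prop where
  n_pos : 0 < d.n
  p_nonneg : ∀ i < d.n, 0 ≤ d.p i
  q_nonneg : ∀ i < d.n, 0 ≤ d.q i
  G_pos : 0 < d.G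
  Cd_pos : 0 < d.Cd
  sum_c : ∑ i ∈ Finset.range d.n, |d.c i| ≤ d.M
  sum_p : ∑ i ∈ Finset.range d.n, |d.p i| ≤ d.M
  sum_q : ∑ i ∈ Finset.range d.n, |d.q i| ≤ d.M
  len_n : len ((d.n : ℤ) + 3) ≤ b
  len_c : ∀ i < d.n + 3, len (d.c i) ≤ b
  len_p : ∀ i < d.n + 3, len (d.p i) ≤ b
  len_q : ∀ i < d.n + 3, len (d.q i) ≤ b
  len_M : len d.M ≤ b
  len_G : len d.G ≤ b

/-- The memory holds the data; arrays `0` and `10`, …, `15` are used. -/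
structure Loaded (σ : Mem) : Prop where
  n : σ 0 0 = d.n
  Cn : σ 0 1 = d.Cn
  Cd : σ 0 2 = d.Cd
  c : ∀ i < d.n + 3, σ 10 (i : ℕ) = d.c i
  p : ∀ i < d.n + 3, σ 11 (i : ℕ) = d.p i
  q : ∀ i < d.n + 3, σ 12 (i : ℕ) = d.q i
  D : σ 13 0 = d.D
  M : σ 14 0 = d.M
  G : σ 15 0 = d.G

variable {d}

theorem Loaded.frame {σ τ : Mem} {P : Prog} (h : d.Loaded σ)
    (hf : ∀ A, A ∉ P.targets → τ A = σ A)
    (hP : ∀ A ∈ P.targets, 20 ≤ A ∨ A = 7 ∨ A = 8) : d.Loaded τ := by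
  have key : ∀ A, ¬(20 ≤ A ∨ A = 7 ∨ A = 8) → τ A = σ A := fun A hA => hf A fun h => hA (hP A h)
  have h0 := key 0 (by decide)
  have h10 := key 10 (by decide)
  have h11 := key 11 (by decide)
  have h12 := key 12 (by decide)
  have h13 := key 13 (by decide)
  have h14 := key 14 (by decide)
  have h15 := key 15 (by decide)
  constructor
  · rw [h0, h.n]
  · rw [h0, h.Cn]
  · rw [h0, h.Cd]
  · intro i hi; rw [h10, h.c i hi]
  · intro i hi; rw [h11, h.p i hi]
  · intro i hi; rw [h12, h.q i hi]
  · rw [h13, h.D]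
  · rw [h14, h.M]
  · rw [h15, h.G]

theorem Loaded.write {σ : Mem} (h : d.Loaded σ) {A : ℕ} (hA : 20 ≤ A) (i v : ℤ) :
    d.Loaded (write σ A i v) :=
  h.frame (P := Prog.set A (Expr.const i) (Expr.const v))
    (fun A' hA' => write_of_ne _ (by simpa [Prog.targets] using hA') _ _)
    (fun A' hA' => Or.inl (by simpa [Prog.targets] using (by simpa [Prog.targets] using hA' : A' = A) ▸ hA))

variable (d)

/-- Item `i` is selected before item `k` in the order of direction `(s, t)`.  Since `k - i` is
smaller than `n` in absolute value, the single comparison says that the difference of the ratios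
decides, and the index in the case of a tie. -/
def Before (s t : ℤ) (k i : ℕ) : Prop :=
  0 < (d.c k * (s * d.p i + t * d.q i) - d.c i * (s * d.p k + t * d.q k)) * d.n + k - i

instance (s t : ℤ) (k : ℕ) : DecidablePred (d.Before s t k) :=
  fun _ => inferInstanceAs (Decidable (0 < _))

/-- The items that are selected before item `k` in the order of direction `(s, t)`. -/
def pre (s t : ℤ) (k : ℕ) : Finset ℕ := (Finset.range d.n).filter (d.Before s t k)

/-- The slack in the constraint, multiplied by all denominators, for the full items `S` and the
fraction `l / G` of item `k`. -/
def slack (S : Finset ℕ) (k : ℕ) (l : ℤ) : ℤ :=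
  ((d.G * ∑ i ∈ S, d.p i + l * d.p k) * (d.G * ∑ i ∈ S, d.p i + l * d.p k) +
    (d.G * ∑ i ∈ S, d.q i + l * d.q k) * (d.G * ∑ i ∈ S, d.q i + l * d.q k)) * d.Cd -
    d.Cn * ((d.D * d.G) * (d.D * d.G))

/-- The scaled cost of the full items `S` and the fraction `l / G` of item `k`. -/
def value (S : Finset ℕ) (k : ℕ) (l : ℤ) : ℤ := (∑ i ∈ S, d.c i) * d.G + l * d.c k

/-- The fractional item encoded in `m`. -/
def item (m : ℕ) : ℕ := m % d.n

/-- The `a`-th of the four items encoded in `m` that determine a direction. -/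
def pick (m a : ℕ) : ℕ := m / d.n / (d.n + 3) ^ a % (d.n + 3)

/-- The first coordinate of the direction encoded in `m`. -/
def dirX (m : ℕ) : ℤ :=
  (d.c (d.pick m 0) * d.q (d.pick m 1) - d.c (d.pick m 1) * d.q (d.pick m 0)) +
  (d.c (d.pick m 2) * d.q (d.pick m 3) - d.c (d.pick m 3) * d.q (d.pick m 2))

/-- The second coordinate of the direction encoded in `m`. -/
def dirY (m : ℕ) : ℤ :=
  (d.c (d.pick m 1) * d.p (d.pick m 0) - d.c (d.pick m 0) * d.p (d.pick m 1)) +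
  (d.c (d.pick m 3) * d.p (d.pick m 2) - d.c (d.pick m 2) * d.p (d.pick m 3))

/-- The full items encoded in `m`. -/
def full (m : ℕ) : Finset ℕ := d.pre (d.dirX m) (d.dirY m) (d.item m)

/-- The number of codes of candidates. -/
def codes : ℕ := d.n * (d.n + 3) ^ 4

variable {d}

theorem not_mem_pre (s t : ℤ) (k : ℕ) : k ∉ d.pre s t k := by
  simp [pre, Before]

theorem pre_subset (s t : ℤ) (k : ℕ) : d.pre s t k ⊆ Finset.range d.n := Finset.filter_subset _ _

/-- Every choice of two pairs of items and of a fractional item has a code. -/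
theorem exists_code (hn : 0 < d.n) {i₁ j₁ i₂ j₂ k : ℕ} (hi₁ : i₁ < d.n + 3) (hj₁ : j₁ < d.n + 3)
    (hi₂ : i₂ < d.n + 3) (hj₂ : j₂ < d.n + 3) (hk : k < d.n) :
    ∃ m < d.codes, d.item m = k ∧ d.pick m 0 = i₁ ∧ d.pick m 1 = j₁ ∧ d.pick m 2 = i₂ ∧
      d.pick m 3 = j₂ := by
  have hb : 0 < d.n + 3 := by omega
  generalize hB : d.n + 3 = b at *
  have hmod : ∀ {x y}, x < b → (x + b * y) % b = x := fun {x y} hx => by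
    rw [Nat.add_mul_mod_self_left, Nat.mod_eq_of_lt hx]
  have hdiv : ∀ {x y}, x < b → (x + b * y) / b = y := fun {x y} hx => by
    rw [Nat.add_mul_div_left _ _ hb, Nat.div_eq_of_lt hx, zero_add]
  have hlt : ∀ {x y r}, x < b → y < r → x + b * y < b * r := fun {x y r} hx hy => by
    nlinarith [Nat.mul_le_mul_left b (Nat.succ_le_of_lt hy)]
  refine ⟨k + d.n * (i₁ + b * (j₁ + b * (i₂ + b * j₂))), ?_, ?_⟩
  · have h : i₁ + b * (j₁ + b * (i₂ + b * j₂)) < b ^ 4 := by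
      rw [show b ^ 4 = b * (b * (b * b)) by ring]
      exact hlt hi₁ (hlt hj₁ (hlt hi₂ hj₂))
    rw [codes, hB]
    nlinarith [Nat.mul_le_mul_left d.n (Nat.succ_le_of_lt h)]
  · have h : (k + d.n * (i₁ + b * (j₁ + b * (i₂ + b * j₂)))) / d.n =
        i₁ + b * (j₁ + b * (i₂ + b * j₂)) := by
      rw [Nat.add_mul_div_left _ _ hn, Nat.div_eq_of_lt hk, zero_add]
    simp only [pick, item, h, hB]
    refine ⟨by rw [Nat.add_mul_mod_self_left, Nat.mod_eq_of_lt hk], ?_, ?_, ?_, ?_⟩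
    · rw [pow_zero, Nat.div_one, hmod hi₁]
    · rw [pow_one, hdiv hi₁, hmod hj₁]
    · rw [pow_succ, pow_one, ← Nat.div_div_eq_div_mul, hdiv hi₁, hdiv hj₁, hmod hi₂]
    · rw [pow_succ, pow_succ, pow_one, ← Nat.div_div_eq_div_mul, ← Nat.div_div_eq_div_mul,
        hdiv hi₁, hdiv hj₁, hdiv hi₂, Nat.mod_eq_of_lt hj₂]

theorem slack_mono {b : ℕ} (hd : d.Tame b) {S : Finset ℕ} (hS : S ⊆ Finset.range d.n) {k : ℕ}
    (hk : k < d.n) {l l' : ℤ} (hl : 0 ≤ l) (hll : l ≤ l') : d.slack S k l ≤ d.slack S k l' := by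
  have h1 : 0 ≤ ∑ i ∈ S, d.p i :=
    Finset.sum_nonneg fun i hi => hd.p_nonneg i (Finset.mem_range.1 (hS hi))
  have h2 : 0 ≤ ∑ i ∈ S, d.q i :=
    Finset.sum_nonneg fun i hi => hd.q_nonneg i (Finset.mem_range.1 (hS hi))
  have h3 := hd.p_nonneg k hk
  have h4 := hd.q_nonneg k hk
  have h5 := hd.G_pos.le
  have h6 := hd.Cd_pos.le
  have h7 : 0 ≤ l' := hl.trans hll
  unfold slack
  gcongr

theorem len_partial_sum_le {f : ℕ → ℤ} {n j : ℕ} {M : ℤ} (hM : ∑ i ∈ Finset.range n, |f i| ≤ M)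
    (hj : j ≤ n) (r : ℕ → Prop) [DecidablePred r] :
    len (∑ i ∈ Finset.range j, if r i then f i else 0) ≤ len M := by
  apply len_mono
  calc |∑ i ∈ Finset.range j, if r i then f i else 0|
      ≤ ∑ i ∈ Finset.range j, |if r i then f i else 0| := Finset.abs_sum_le_sum_abs _ _
    _ ≤ ∑ i ∈ Finset.range j, |f i| := Finset.sum_le_sum fun i _ => by
        split_ifs
        · exact le_rfl
        · simp
    _ ≤ ∑ i ∈ Finset.range n, |f i| := Finset.sum_le_sum_of_subset_of_nonneg
        (Finset.range_subset_range.2 hj) fun _ _ _ => abs_nonneg _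
    _ ≤ |M| := hM.trans (le_abs_self _)

theorem len_cast_mono {a b : ℕ} (h : a ≤ b) : len (a : ℤ) ≤ len (b : ℤ) :=
  len_mono (by simpa using h)

theorem Tame.len_index {b : ℕ} (hd : d.Tame b) {i : ℕ} (hi : i ≤ d.n + 3) : len (i : ℤ) ≤ b :=
  (len_cast_mono hi).trans (by simpa using hd.len_n)

theorem Tame.len_pre {b : ℕ} (hd : d.Tame b) {f : ℕ → ℤ}
    (hf : ∑ i ∈ Finset.range d.n, |f i| ≤ d.M) (s t : ℤ) (k : ℕ) :
    len (∑ i ∈ d.pre s t k, f i) ≤ b := by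
  rw [pre, Finset.sum_filter]
  exact (len_partial_sum_le hf le_rfl _).trans hd.len_M

end GridData

namespace Search

open Expr Prog GridData

/-- The number of items. -/
def nItems : Expr := get 0 (const 0)

/-- The last digit of `x` in base `b`. -/
def lastDigit (b x : Expr) : Expr := x - x / b * b

/-- The first coordinate of the critical direction of two items. -/
def critX (i j : Expr) : Expr := get 10 i * get 12 j - get 10 j * get 12 i

/-- The second coordinate of the critical direction of two items. -/
def critY (i j : Expr) : Expr := get 10 j * get 11 i - get 10 i * get 11 j

/-- Decodes the register `20` into a fractional item (`21`) and a direction (`23`, `24`). -/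
def decodeProg : Prog :=
  setReg 21 (lastDigit nItems (reg 20)) ;;
  setReg 22 (reg 20 / nItems) ;;
  setReg 35 (lastDigit (nItems + const 3) (reg 22)) ;;
  setReg 22 (reg 22 / (nItems + const 3)) ;;
  setReg 36 (lastDigit (nItems + const 3) (reg 22)) ;;
  setReg 22 (reg 22 / (nItems + const 3)) ;;
  setReg 37 (lastDigit (nItems + const 3) (reg 22)) ;;
  setReg 22 (reg 22 / (nItems + const 3)) ;;
  setReg 38 (lastDigit (nItems + const 3) (reg 22)) ;;
  setReg 23 (critX (reg 35) (reg 36) + critX (reg 37) (reg 38)) ;;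
  setReg 24 (critY (reg 35) (reg 36) + critY (reg 37) (reg 38))

/-- Positive if the item in register `28` is selected before the one in register `21`. -/
def beforeExpr : Expr :=
  (get 10 (reg 21) * (reg 23 * get 11 (reg 28) + reg 24 * get 12 (reg 28)) -
    get 10 (reg 28) * (reg 23 * get 11 (reg 21) + reg 24 * get 12 (reg 21))) * nItems +
    reg 21 - reg 28

/-- Writes the selected items to array `29`, and their sums to the registers `25`, `26`, `27`. -/
def collectProg : Prog :=
  setReg 25 (const 0) ;; setReg 26 (const 0) ;; setReg 27 (const 0) ;; setReg 28 (const 0) ;;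
  loop (nItems - reg 28)
    (branch beforeExpr
      (set 29 (reg 28) (reg 15) ;;
        setReg 25 (reg 25 + get 10 (reg 28)) ;;
        setReg 26 (reg 26 + get 11 (reg 28)) ;;
        setReg 27 (reg 27 + get 12 (reg 28)))
      (set 29 (reg 28) (const 0)) ;;
    setReg 28 (reg 28 + const 1))

/-- Positive if `l` grid steps of the fractional item make the candidate feasible. -/
def slackExpr (l : Expr) : Expr :=
  ((reg 15 * reg 26 + l * get 11 (reg 21)) * (reg 15 * reg 26 + l * get 11 (reg 21)) +
    (reg 15 * reg 27 + l * get 12 (reg 21)) * (reg 15 * reg 27 + l * get 12 (reg 21))) *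
      get 0 (const 2) -
    get 0 (const 1) * ((reg 13 * reg 15) * (reg 13 * reg 15)) + const 1

/-- Computes in register `31` the best number of grid steps for the fractional item. -/
def bisectProg : Prog :=
  branch (const 0 - get 10 (reg 21)) (setReg 30 (reg 15 - const 1)) (setReg 30 (const (-1))) ;;
  setReg 31 (reg 15) ;;
  loop (reg 31 - reg 30 - const 1)
    (setReg 34 ((reg 30 + reg 31) / const 2) ;;
      branch (slackExpr (reg 34)) (setReg 31 (reg 34)) (setReg 30 (reg 34)))

/-- Copies array `29` to the output if its value is less than the one in register `33`. -/
def updateProg : Prog :=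
  setReg 32 (reg 25 * reg 15 + reg 31 * get 10 (reg 21)) ;;
  branch (reg 33 - reg 32)
    (setReg 33 (reg 32) ;; set 29 (reg 21) (reg 31) ;; setReg 28 (const 0) ;;
      loop (nItems - reg 28)
        (set 7 (reg 28) (get 29 (reg 28)) ;; set 8 (reg 28) (reg 15) ;;
          setReg 28 (reg 28 + const 1)))
    skip

/-- Treats the candidate with the code in register `20`. -/
def candidateProg : Prog :=
  decodeProg ;; collectProg ;; branch (slackExpr (reg 15)) (bisectProg ;; updateProg) skip ;;
  setReg 20 (reg 20 + const 1)

variable {d : GridData} {b B : ℕ} {σ : Mem}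

theorem critX_eval (hσ : d.Loaded σ) {e f : Expr} {i j : ℕ} (hi : i < d.n + 3) (hj : j < d.n + 3)
    (he : e.eval σ = i) (hf : f.eval σ = j) :
    (critX e f).eval σ = d.c i * d.q j - d.c j * d.q i := by
  simp only [critX, eval_sub, eval_mul, eval_get, he, hf, hσ.c i hi, hσ.c j hj, hσ.q i hi,
    hσ.q j hj]

theorem critY_eval (hσ : d.Loaded σ) {e f : Expr} {i j : ℕ} (hi : i < d.n + 3) (hj : j < d.n + 3)
    (he : e.eval σ = i) (hf : f.eval σ = j) :
    (critY e f).eval σ = d.c j * d.p i - d.c i * d.p j := by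
  simp only [critY, eval_sub, eval_mul, eval_get, he, hf, hσ.c i hi, hσ.c j hj, hσ.p i hi,
    hσ.p j hj]

theorem lastDigit_eval {e f : Expr} {x y : ℕ} (he : e.eval σ = y) (hf : f.eval σ = x) :
    (lastDigit e f).eval σ = ((x % y : ℕ) : ℤ) := by
  simp only [lastDigit, eval_sub, eval_mul, eval_div, he, hf]
  push_cast
  rw [Int.emod_def, mul_comm]

theorem decodeProg_halts (hd : d.Tame b) (hB : 20 * b ≤ B) (hb : Bounded B σ) (hσ : d.Loaded σ)
    {m : ℕ} (hm : σ 20 0 = m) :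
    Halts B decodeProg 11 σ fun τ =>
      τ 21 0 = d.item m ∧ τ 23 0 = d.dirX m ∧ τ 24 0 = d.dirY m := by
  have hn := hd.n_pos
  have hlm : ∀ r : ℕ, r ≤ m → len (r : ℤ) ≤ B := fun r hr =>
    (len_cast_mono hr).trans (hm ▸ hb 20 0)
  have hlp : ∀ a, len ((d.pick m a : ℕ) : ℤ) ≤ B := fun a =>
    (hd.len_index (Nat.mod_lt _ (by omega)).le).trans (by omega)
  have hp : ∀ a, d.pick m a < d.n + 3 := fun a => Nat.mod_lt _ (by omega)
  have hq : ∀ a, m / d.n / (d.n + 3) ^ a ≤ m := fun a =>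
    (Nat.div_le_self _ _).trans (Nat.div_le_self _ _)
  have hs : ∀ a, m / d.n / (d.n + 3) ^ a / (d.n + 3) = m / d.n / (d.n + 3) ^ (a + 1) := fun a => by
    rw [Nat.div_div_eq_div_mul, ← pow_succ]
  have hcc : ∀ {f g : ℕ → ℤ}, (∀ i < d.n + 3, len (f i) ≤ b) → (∀ i < d.n + 3, len (g i) ≤ b) →
      ∀ i j i' j', i < d.n + 3 → j < d.n + 3 → i' < d.n + 3 → j' < d.n + 3 →
      len ((f i * g j - f j * g i) + (f i' * g j' - f j' * g i')) ≤ B := by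
    intro f g hf hg i j i' j' hi hj hi' hj'
    exact (len_add_le
      (len_sub_le (len_mul_le (hf i hi) (hg j hj)) (len_mul_le (hf j hj) (hg i hi)))
      (len_sub_le (len_mul_le (hf i' hi') (hg j' hj')) (len_mul_le (hf j' hj') (hg i' hi')))).trans
        (by omega)
  have e3 : (nItems + const 3).eval σ = ((d.n + 3 : ℕ) : ℤ) := by
    simp [eval_add, eval_const, nItems, eval_get, hσ.n]
  have e0 : nItems.eval σ = d.n := hσ.n
  unfold decodeProg
  refine Halts.regThen hb (d.item m) ?_ (hlm _ (Nat.mod_le _ _)) fun hb => ?_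
  · exact lastDigit_eval e0 hm
  refine Halts.regThen hb ((m / d.n / (d.n + 3) ^ 0 : ℕ) : ℤ) ?_ (hlm _ (hq 0)) fun hb => ?_
  · simp [eval_div, eval_reg, nItems, eval_get, eval_const, write_apply, hm, hσ.n]
  refine Halts.regThen hb (d.pick m 0) (lastDigit_eval ?_ ?_) (hlp 0) fun hb => ?_
  · simp [eval_add, nItems, eval_get, eval_const, write_apply, hσ.n]
  · simp only [eval_reg, write_apply, and_self, if_true]
  refine Halts.regThen hb ((m / d.n / (d.n + 3) ^ 1 : ℕ) : ℤ) ?_ (hlm _ (hq 1)) fun hb => ?_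
  · rw [← hs 0]
    simp [eval_add, eval_div, eval_reg, nItems, eval_get, eval_const, write_apply, hσ.n]
  refine Halts.regThen hb (d.pick m 1) (lastDigit_eval ?_ ?_) (hlp 1) fun hb => ?_
  · simp [eval_add, nItems, eval_get, eval_const, write_apply, hσ.n]
  · simp only [eval_reg, write_apply, and_self, if_true]
  refine Halts.regThen hb ((m / d.n / (d.n + 3) ^ 2 : ℕ) : ℤ) ?_ (hlm _ (hq 2)) fun hb => ?_
  · rw [← hs 1]
    simp [eval_add, eval_div, eval_reg, nItems, eval_get, eval_const, write_apply, hσ.n]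
  refine Halts.regThen hb (d.pick m 2) (lastDigit_eval ?_ ?_) (hlp 2) fun hb => ?_
  · simp [eval_add, nItems, eval_get, eval_const, write_apply, hσ.n]
  · simp only [eval_reg, write_apply, and_self, if_true]
  refine Halts.regThen hb ((m / d.n / (d.n + 3) ^ 3 : ℕ) : ℤ) ?_ (hlm _ (hq 3)) fun hb => ?_
  · rw [← hs 2]
    simp [eval_add, eval_div, eval_reg, nItems, eval_get, eval_const, write_apply, hσ.n]
  refine Halts.regThen hb (d.pick m 3) (lastDigit_eval ?_ ?_) (hlp 3) fun hb => ?_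
  · simp [eval_add, nItems, eval_get, eval_const, write_apply, hσ.n]
  · simp only [eval_reg, write_apply, and_self, if_true]
  have hL : d.Loaded (write (write (write (write (write (write (write (write (write σ 21 0
      (d.item m)) 22 0 ((m / d.n / (d.n + 3) ^ 0 : ℕ) : ℤ)) 35 0 (d.pick m 0)) 22 0
      ((m / d.n / (d.n + 3) ^ 1 : ℕ) : ℤ)) 36 0 (d.pick m 1)) 22 0
      ((m / d.n / (d.n + 3) ^ 2 : ℕ) : ℤ)) 37 0 (d.pick m 2)) 22 0
      ((m / d.n / (d.n + 3) ^ 3 : ℕ) : ℤ)) 38 0 (d.pick m 3)) := by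
    iterate 9 refine Loaded.write ?_ (by norm_num) _ _
    exact hσ
  refine Halts.regThen hb (d.dirX m) ?_
    (hcc hd.len_c hd.len_q _ _ _ _ (hp _) (hp _) (hp _) (hp _)) fun hb => ?_
  · rw [eval_add, critX_eval hL (hp 0) (hp 1), critX_eval hL (hp 2) (hp 3), dirX] <;>
      simp [eval_reg, write_apply]
  refine Halts.regLast hb (d.dirY m) ?_ ?_ ?_
  · rw [eval_add, critY_eval (hL.write (by norm_num) _ _) (hp 0) (hp 1),
      critY_eval (hL.write (by norm_num) _ _) (hp 2) (hp 3), dirY] <;>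
      simp [eval_reg, write_apply]
  · rw [dirY]
    exact hcc hd.len_c hd.len_p _ _ _ _ (hp _) (hp _) (hp _) (hp _)
  · simp [write_apply]

end Search

namespace Search

open Expr Prog GridData

variable {d : GridData} {b B : ℕ} {σ : Mem}

theorem beforeExpr_eval (hσ : d.Loaded σ) {s t : ℤ} {k i : ℕ} (hk : k < d.n) (hi : i < d.n)
    (h21 : σ 21 0 = k) (h23 : σ 23 0 = s) (h24 : σ 24 0 = t) (h28 : σ 28 0 = i) :
    0 < beforeExpr.eval σ ↔ d.Before s t k i := by
  simp only [beforeExpr, eval_sub, eval_mul, eval_add, eval_get, eval_reg, nItems, eval_const,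
    h21, h23, h24, h28, hσ.n, hσ.c k (by omega), hσ.c i (by omega), hσ.p k (by omega),
    hσ.p i (by omega), hσ.q k (by omega), hσ.q i (by omega), Before]

theorem len_zero_le (hb : Bounded B σ) : len 0 ≤ B := by
  simpa [len] using hb.one_le

theorem collectProg_halts (hd : d.Tame b) (hB : 20 * b ≤ B) (hb : Bounded B σ) (hσ : d.Loaded σ)
    {k : ℕ} (hk : k < d.n) {s t : ℤ} (h21 : σ 21 0 = k) (h23 : σ 23 0 = s) (h24 : σ 24 0 = t) :
    Halts B collectProg (d.n * 7 + 5) σ fun τ =>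
      τ 25 0 = ∑ i ∈ d.pre s t k, d.c i ∧ τ 26 0 = ∑ i ∈ d.pre s t k, d.p i ∧
      τ 27 0 = ∑ i ∈ d.pre s t k, d.q i ∧
      ∀ i < d.n, τ 29 (i : ℕ) = if i ∈ d.pre s t k then d.G else 0 := by
  have hz := len_zero_le hb
  unfold collectProg
  refine Halts.regThen hb 0 rfl hz fun hb => Halts.regThen hb 0 rfl hz fun hb =>
    Halts.regThen hb 0 rfl hz fun hb => Halts.regThen hb 0 rfl hz fun hb => ?_
  let J : ℕ → Mem → Prop := fun j τ => τ 28 0 = j ∧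
    τ 25 0 = (∑ i ∈ Finset.range j, if d.Before s t k i then d.c i else 0) ∧
    τ 26 0 = (∑ i ∈ Finset.range j, if d.Before s t k i then d.p i else 0) ∧
    τ 27 0 = (∑ i ∈ Finset.range j, if d.Before s t k i then d.q i else 0) ∧
    ∀ i < j, τ 29 (i : ℕ) = if d.Before s t k i then d.G else 0
  refine (Halts.forLoop (s := 6) J d.n hb ?_ ?_ ?_).mono le_rfl ?_
  · simp [J, write_apply]
  · rintro j τ hf - ⟨h28, -⟩
    have h0 : τ 0 0 = d.n := by rw [hf 0 (by decide), ← hσ.n]; rfl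
    rw [eval_sub, eval_reg, h28, nItems, eval_get, eval_const, h0]
    omega
  · rintro j τ hb hf hj ⟨h28, h25, h26, h27, h29⟩
    have hτ : d.Loaded τ := by
      refine Loaded.frame (((((hσ.write ?_ _ _).write ?_ _ _).write ?_ _ _).write ?_ _ _)) hf
        (by decide) <;> norm_num
    have g21 : τ 21 0 = k := by rw [hf 21 (by decide)]; simpa [write_apply] using h21
    have g23 : τ 23 0 = s := by rw [hf 23 (by decide)]; simpa [write_apply] using h23
    have g24 : τ 24 0 = t := by rw [hf 24 (by decide)]; simpa [write_apply] using h24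
    have hbef := beforeExpr_eval hτ hk hj g21 g23 g24 h28
    have hlen : ∀ {f : ℕ → ℤ}, ∑ i ∈ Finset.range d.n, |f i| ≤ d.M →
        len (∑ i ∈ Finset.range (j + 1), if d.Before s t k i then f i else 0) ≤ B := fun hf =>
      (len_partial_sum_le hf hj _).trans (hd.len_M.trans (by omega))
    have hsucc : ∀ f : ℕ → ℤ, d.Before s t k j →
        (∑ i ∈ Finset.range j, if d.Before s t k i then f i else 0) + f j =
          ∑ i ∈ Finset.range (j + 1), if d.Before s t k i then f i else 0 := fun f h => by
      rw [Finset.sum_range_succ, if_pos h]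
    have hsucc' : ∀ f : ℕ → ℤ, ¬ d.Before s t k j →
        (∑ i ∈ Finset.range j, if d.Before s t k i then f i else 0) =
          ∑ i ∈ Finset.range (j + 1), if d.Before s t k i then f i else 0 := fun f h => by
      rw [Finset.sum_range_succ, if_neg h, add_zero]
    have key : Halts B (branch beforeExpr
        (set 29 (reg 28) (reg 15) ;; setReg 25 (reg 25 + get 10 (reg 28)) ;;
          setReg 26 (reg 26 + get 11 (reg 28)) ;; setReg 27 (reg 27 + get 12 (reg 28)))
        (set 29 (reg 28) (const 0))) 5 τ fun υ => υ 28 0 = j ∧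
        υ 25 0 = (∑ i ∈ Finset.range (j + 1), if d.Before s t k i then d.c i else 0) ∧
        υ 26 0 = (∑ i ∈ Finset.range (j + 1), if d.Before s t k i then d.p i else 0) ∧
        υ 27 0 = (∑ i ∈ Finset.range (j + 1), if d.Before s t k i then d.q i else 0) ∧
        ∀ i < j + 1, υ 29 (i : ℕ) = if d.Before s t k i then d.G else 0 := by
      refine Halts.branch hb (fun hg => ?_) (fun hg => ?_)
      · have hj' := hbef.1 hg
        refine Halts.setThen hb j d.G h28 hτ.G (hd.len_G.trans (by omega)) fun hb => ?_
        refine Halts.regThen hb (∑ i ∈ Finset.range (j + 1), if d.Before s t k i then d.c i else 0)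
          ?_ (hlen hd.sum_c) fun hb => ?_
        · simp [eval_add, eval_reg, eval_get, write_apply, h28, h25, hτ.c j (by omega), ← hsucc _ hj']
        refine Halts.regThen hb (∑ i ∈ Finset.range (j + 1), if d.Before s t k i then d.p i else 0)
          ?_ (hlen hd.sum_p) fun hb => ?_
        · simp [eval_add, eval_reg, eval_get, write_apply, h28, h26, hτ.p j (by omega), ← hsucc _ hj']
        refine Halts.regLast hb (∑ i ∈ Finset.range (j + 1), if d.Before s t k i then d.q i else 0)
          ?_ (hlen hd.sum_q) ?_
        · simp [eval_add, eval_reg, eval_get, write_apply, h28, h27, hτ.q j (by omega), ← hsucc _ hj']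
        refine ⟨by simp [write_apply, h28], by simp [write_apply], by simp [write_apply],
          by simp [write_apply], fun i hi => ?_⟩
        rcases Nat.lt_succ_iff_lt_or_eq.1 hi with hi | rfl
        · simp [write_apply, hi.ne, h29 i hi]
        · simp [write_apply, hj']
      · have hj' : ¬ d.Before s t k j := fun h => absurd (hbef.2 h) (not_lt.2 hg)
        refine Halts.mono (s := 1) (Halts.setLast hb j 0 (by exact h28) rfl hz ?_) (by norm_num)
          (fun _ _ _ h => h)
        rw [← hsucc' _ hj', ← hsucc' _ hj', ← hsucc' _ hj']
        refine ⟨by simp [write_apply, h28], by simp [write_apply, h25], by simp [write_apply, h26],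
          by simp [write_apply, h27], fun i hi => ?_⟩
        rcases Nat.lt_succ_iff_lt_or_eq.1 hi with hi | rfl
        · simp [write_apply, hi.ne, h29 i hi]
        · simp [write_apply, hj']
    refine key.seq fun υ hb _ ⟨k28, k25, k26, k27, k29⟩ => ?_
    refine Halts.regLast hb ((j + 1 : ℕ) : ℤ) ?_ ((hd.len_index (by omega)).trans (by omega)) ?_
    · simp [eval_add, eval_reg, eval_const, k28]
    · refine ⟨by simp [write_apply], by simp [write_apply, k25], by simp [write_apply, k26],
        by simp [write_apply, k27], fun i hi => by simp [write_apply, k29 i hi]⟩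
  · rintro τ - - ⟨-, h25, h26, h27, h29⟩
    simp only [pre, Finset.sum_filter]
    refine ⟨h25, h26, h27, fun i hi => ?_⟩
    rw [h29 i hi]
    simp [hi]

theorem slackExpr_eval (hσ : d.Loaded σ) {e : Expr} {l : ℤ} {S : Finset ℕ} {k : ℕ} (hk : k < d.n)
    (h21 : σ 21 0 = k) (h26 : σ 26 0 = ∑ i ∈ S, d.p i) (h27 : σ 27 0 = ∑ i ∈ S, d.q i)
    (he : e.eval σ = l) : 0 < (slackExpr e).eval σ ↔ 0 ≤ d.slack S k l := by
  simp only [slackExpr, eval_sub, eval_mul, eval_add, eval_get, eval_reg, eval_const,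
    h21, h26, h27, hσ.Cn, hσ.Cd, hσ.D, hσ.G, hσ.p k (by omega), hσ.q k (by omega), he, slack]
  omega

/-- If the candidate is feasible with all of item `k`, then the bisection finds a feasible number
of grid steps of least cost: the least feasible one if the cost of `k` is nonnegative, and `G`
otherwise. -/
theorem bisectProg_halts (hd : d.Tame b) (hB : 20 * b ≤ B) (hb : Bounded B σ) (hσ : d.Loaded σ)
    {S : Finset ℕ} (hS : S ⊆ Finset.range d.n) {k : ℕ} (hk : k < d.n) (h21 : σ 21 0 = k)
    (h26 : σ 26 0 = ∑ i ∈ S, d.p i) (h27 : σ 27 0 = ∑ i ∈ S, d.q i)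
    (hfeas : 0 ≤ d.slack S k d.G) :
    Halts B bisectProg (b * 4 + 4) σ fun τ =>
      0 ≤ τ 31 0 ∧ τ 31 0 ≤ d.G ∧ 0 ≤ d.slack S k (τ 31 0) ∧
      ∀ l, 0 ≤ l → l ≤ d.G → 0 ≤ d.slack S k l → τ 31 0 * d.c k ≤ l * d.c k := by
  have hG := hd.G_pos
  have hlG : ∀ l, -1 ≤ l → l ≤ d.G → len l ≤ B := fun l h1 h2 =>
    (len_mono (abs_le_abs (by omega) (by omega))).trans (hd.len_G.trans (by omega))
  unfold bisectProg
  have h1 : Halts B (branch (const 0 - get 10 (reg 21)) (setReg 30 (reg 15 - const 1))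
      (setReg 30 (const (-1)))) 2 σ fun τ =>
      (d.c k < 0 → τ 30 0 = d.G - 1) ∧ (0 ≤ d.c k → τ 30 0 = -1) := by
    have he : (const 0 - get 10 (reg 21)).eval σ = - d.c k := by
      simp [eval_sub, eval_const, eval_get, eval_reg, h21, hσ.c k (by omega)]
    refine Halts.branch hb (fun hg => ?_) (fun hg => ?_)
    · rw [he] at hg
      refine Halts.regLast hb (d.G - 1) (by rw [eval_sub, eval_reg, hσ.G]; rfl)
        (hlG _ (by omega) (by omega)) ⟨fun _ => by simp [write_apply], fun h => by omega⟩
    · rw [he] at hg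
      refine Halts.regLast hb (-1) rfl (hlG _ (by omega) (by omega))
        ⟨fun h => by omega, fun h => by simp [write_apply]⟩
  refine (h1.seq (s' := b * 4 + 2) fun σ₁ hb hf₁ ⟨hneg, hpos⟩ => ?_).mono (by omega) fun _ _ _ h => h
  have hσ₁ : d.Loaded σ₁ := hσ.frame hf₁ (by decide)
  refine Halts.regThen hb d.G hσ₁.G (hlG _ (by omega) le_rfl) fun hb => ?_
  have hσ₂ : d.Loaded (write σ₁ 31 0 d.G) := hσ₁.write (by norm_num) _ _
  -- the lower end `-1` is never tested, so that the upper end can come down to `0`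
  let J : ℕ → Mem → Prop := fun j τ => -1 ≤ τ 30 0 ∧ τ 30 0 < τ 31 0 ∧ τ 31 0 ≤ d.G ∧
    τ 31 0 - τ 30 0 ≤ 2 ^ j ∧ 0 ≤ d.slack S k (τ 31 0) ∧
    (d.c k < 0 → τ 30 0 = d.G - 1) ∧
    (0 ≤ d.c k → ∀ l, 0 ≤ l → l ≤ τ 30 0 → d.slack S k l < 0)
  refine (Halts.loop (s := 3) J (T := b) hb ?_ ?_).mono (by omega) ?_
  · have hpow : d.G + 1 ≤ 2 ^ b := by
      have h1 := natAbs_lt_two_pow_len d.G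
      have h2 : 2 ^ (len d.G - 1) ≤ 2 ^ b :=
        Nat.pow_le_pow_right two_pos (by have := hd.len_G; omega)
      have h3 : d.G.natAbs + 1 ≤ 2 ^ b := by omega
      have h4 : ((d.G.natAbs : ℕ) : ℤ) + 1 ≤ 2 ^ b := by exact_mod_cast h3
      omega
    simp only [J, write_apply]
    norm_num
    rcases lt_or_ge (d.c k) 0 with hc | hc
    · have := hneg hc
      refine ⟨by omega, by omega, by omega, hfeas, fun _ => this, fun h => absurd hc (not_lt.2 h)⟩
    · have := hpos hc
      refine ⟨by omega, by omega, by omega, hfeas, fun h => absurd h (not_lt.2 hc), fun _ l h h' => ?_⟩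
      omega
  · rintro j τ hb hf ⟨i1, i2, i3, i4, i5, i6, i7⟩ hg
    have hτ : d.Loaded τ := hσ₂.frame hf (by decide)
    have g21 : τ 21 0 = k := by
      rw [hf 21 (by decide), write_of_ne _ (by decide), hf₁ 21 (by decide), h21]
    have g26 : τ 26 0 = ∑ i ∈ S, d.p i := by
      rw [hf 26 (by decide), write_of_ne _ (by decide), hf₁ 26 (by decide), h26]
    have g27 : τ 27 0 = ∑ i ∈ S, d.q i := by
      rw [hf 27 (by decide), write_of_ne _ (by decide), hf₁ 27 (by decide), h27]
    simp only [eval_sub, eval_reg, eval_const] at hg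
    obtain ⟨j, rfl⟩ : ∃ i, j = i + 1 := by
      rcases j with _ | j
      · simp at i4
        omega
      · exact ⟨j, rfl⟩
    refine ⟨j, rfl, ?_⟩
    rw [pow_succ] at i4
    have hmid1 : τ 30 0 < (τ 30 0 + τ 31 0) / 2 := by omega
    have hmid2 : (τ 30 0 + τ 31 0) / 2 < τ 31 0 := by omega
    have hmid3 : τ 31 0 - (τ 30 0 + τ 31 0) / 2 ≤ 2 ^ j := by omega
    have hmid4 : (τ 30 0 + τ 31 0) / 2 - τ 30 0 ≤ 2 ^ j := by omega
    have hc : 0 ≤ d.c k := by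
      by_contra! h
      have := i6 h
      omega
    generalize hmid : (τ 30 0 + τ 31 0) / 2 = mid at *
    refine Halts.regThen hb mid hmid (hlG _ (by omega) (by omega)) fun hb => ?_
    have hex : 0 < (slackExpr (reg 34)).eval (write τ 34 0 mid) ↔ 0 ≤ d.slack S k mid :=
      slackExpr_eval (hτ.write (by norm_num) _ _) hk (by simpa [write_apply] using g21)
        (by simpa [write_apply] using g26) (by simpa [write_apply] using g27)
        (by simp [eval_reg, write_apply])
    refine Halts.branch hb (fun hg => ?_) (fun hg => ?_)
    · refine Halts.regLast hb mid (by simp [eval_reg, write_apply]) (hlG _ (by omega) (by omega)) ?_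
      simp only [J, write_apply]
      norm_num
      exact ⟨i1, hmid1, by omega, by omega, hex.1 hg, fun h => by omega, fun _ => i7 hc⟩
    · have hlt : d.slack S k mid < 0 := by
        by_contra! h
        exact absurd (hex.2 h) (not_lt.2 hg)
      refine Halts.regLast hb mid (by simp [eval_reg, write_apply]) (hlG _ (by omega) (by omega)) ?_
      simp only [J, write_apply]
      norm_num
      exact ⟨by omega, hmid2, by omega, by omega, i5, fun h => by omega, fun _ l h0 hl =>
        (slack_mono hd hS hk h0 hl).trans_lt hlt⟩
  · rintro τ - - ⟨hg, j, i1, i2, i3, i4, i5, i6, i7⟩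
    simp only [eval_sub, eval_reg, eval_const] at hg
    refine ⟨by omega, i3, i5, fun l h0 h1 h2 => ?_⟩
    rcases lt_or_ge (d.c k) 0 with hc | hc
    · have := i6 hc
      exact mul_le_mul_of_nonpos_right (by omega) hc.le
    · refine mul_le_mul_of_nonneg_right ?_ hc
      by_contra! h
      exact absurd (i7 hc l h0 (by omega)) (not_lt.2 h2)

end Search

namespace GridData

variable (d : GridData)

/-- The memory holds in the arrays `7` and `8` a feasible solution of scaled cost `v`. -/
structure Solves (σ : Mem) (v : ℤ) : Prop where
  nonneg : ∀ i < d.n, 0 ≤ σ 7 (i : ℕ)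
  le : ∀ i < d.n, σ 7 (i : ℕ) ≤ d.G
  den : ∀ i < d.n, σ 8 (i : ℕ) = d.G
  cost : ∑ i ∈ Finset.range d.n, d.c i * σ 7 (i : ℕ) = v
  power : d.Cn * ((d.D * d.G) * (d.D * d.G)) ≤
    ((∑ i ∈ Finset.range d.n, d.p i * σ 7 (i : ℕ)) * (∑ i ∈ Finset.range d.n, d.p i * σ 7 (i : ℕ)) +
    (∑ i ∈ Finset.range d.n, d.q i * σ 7 (i : ℕ)) * (∑ i ∈ Finset.range d.n, d.q i * σ 7 (i : ℕ))) *
      d.Cd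

variable {d}

theorem sum_candidate {S : Finset ℕ} (hS : S ⊆ Finset.range d.n) {k : ℕ} (hk : k < d.n)
    (hkS : k ∉ S) (l : ℤ) (f : ℕ → ℤ) :
    ∑ i ∈ Finset.range d.n, f i * (if i = k then l else if i ∈ S then d.G else 0) =
      (∑ i ∈ S, f i) * d.G + l * f k := by
  have : ∀ i, f i * (if i = k then l else if i ∈ S then d.G else 0) =
      (if i ∈ S then f i * d.G else 0) + (if i = k then l * f k else 0) := by
    intro i
    by_cases h1 : i = k
    · subst h1
      simp [hkS, mul_comm]
    · simp [h1]
  simp only [this, Finset.sum_add_distrib, Finset.sum_ite_mem, Finset.sum_ite_eq',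
    Finset.mem_range, hk, if_true, Finset.inter_eq_right.2 hS, Finset.sum_mul]

theorem solves_candidate {S : Finset ℕ} (hS : S ⊆ Finset.range d.n) {k : ℕ} (hk : k < d.n)
    (hkS : k ∉ S) {l : ℤ} (hl0 : 0 ≤ l) (hl1 : l ≤ d.G) (hfeas : 0 ≤ d.slack S k l)
    {σ : Mem} (h7 : ∀ i < d.n, σ 7 (i : ℕ) = if i = k then l else if i ∈ S then d.G else 0)
    (h8 : ∀ i < d.n, σ 8 (i : ℕ) = d.G) : d.Solves σ (d.value S k l) := by
  have hs : ∀ f : ℕ → ℤ, ∑ i ∈ Finset.range d.n, f i * σ 7 (i : ℕ) =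
      (∑ i ∈ S, f i) * d.G + l * f k := fun f => by
    rw [← sum_candidate hS hk hkS]
    exact Finset.sum_congr rfl fun i hi => by rw [h7 i (Finset.mem_range.1 hi)]
  refine ⟨fun i hi => ?_, fun i hi => ?_, h8, hs _, ?_⟩
  · rw [h7 i hi]
    split_ifs <;> omega
  · rw [h7 i hi]
    split_ifs <;> omega
  · rw [hs, hs]
    simp only [slack] at hfeas
    linarith

end GridData

namespace Search

open Expr Prog GridData

variable {d : GridData} {b B : ℕ} {σ : Mem}

/-- The recorded value becomes at most that of the candidate, and the output arrays still hold a
solution with the recorded value. -/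
theorem updateProg_halts (hd : d.Tame b) (hB : 20 * b ≤ B) (hb : Bounded B σ) (hσ : d.Loaded σ)
    {s t : ℤ} {k : ℕ} (hk : k < d.n) (h21 : σ 21 0 = k)
    (h25 : σ 25 0 = ∑ i ∈ d.pre s t k, d.c i)
    (h29 : ∀ i < d.n, σ 29 (i : ℕ) = if i ∈ d.pre s t k then d.G else 0)
    (h33 : len (σ 33 0) ≤ 5 * b) {l : ℤ} (h31 : σ 31 0 = l) (hl0 : 0 ≤ l) (hl1 : l ≤ d.G)
    (hfeas : 0 ≤ d.slack (d.pre s t k) k l)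
    (hsol : σ 33 0 ≤ d.G * d.M → d.Solves σ (σ 33 0)) :
    Halts B updateProg (d.n * 4 + 6) σ fun τ =>
      len (τ 33 0) ≤ 5 * b ∧ τ 33 0 ≤ σ 33 0 ∧ τ 33 0 ≤ d.value (d.pre s t k) k l ∧
      (τ 33 0 ≤ d.G * d.M → d.Solves τ (τ 33 0)) := by
  have hlen : len (d.value (d.pre s t k) k l) ≤ 5 * b := by
    have h1 := hd.len_pre hd.sum_c s t k
    have h2 := hd.len_c k (by omega)
    have h3 := (len_mono (abs_le_abs_of_nonneg hl0 hl1)).trans hd.len_G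
    exact (len_add_le (len_mul_le h1 hd.len_G) (len_mul_le h3 h2)).trans (by omega)
  have hlG : ∀ l, 0 ≤ l → l ≤ d.G → len l ≤ B := fun l h1 h2 =>
    (len_mono (abs_le_abs_of_nonneg h1 h2)).trans (hd.len_G.trans (by omega))
  have hz := len_zero_le hb
  unfold updateProg
  refine Halts.regThen hb (d.value (d.pre s t k) k l) ?_ (hlen.trans (by omega)) fun hb => ?_
  · simp only [eval_add, eval_mul, eval_reg, eval_get, h25, hσ.G, h31, h21, hσ.c k (by omega), value]
  set v := d.value (d.pre s t k) k l with hv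
  refine Halts.branch hb (fun hg => ?_) (fun hg => ?_)
  · have hlt : v < σ 33 0 := by simpa [eval_sub, eval_reg, write_apply] using hg
    refine Halts.regThen hb v (by simp [eval_reg, write_apply]) (hlen.trans (by omega)) fun hb => ?_
    refine Halts.setThen hb k l (by simp [eval_reg, write_apply, h21])
      (by simp [eval_reg, write_apply, h31]) (hlG l hl0 hl1) fun hb => ?_
    refine Halts.regThen hb 0 rfl hz fun hb => ?_
    generalize hσ' : RAM.write (RAM.write (RAM.write (RAM.write σ 32 0 v) 33 0 v) 29 k l) 28 0 0 =
      σ' at *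
    have hL' : d.Loaded σ' := by
      rw [← hσ']
      iterate 4 refine Loaded.write ?_ (by norm_num) _ _
      exact hσ
    have g28 : σ' 28 0 = 0 := by simp [← hσ', write_apply]
    have g33 : σ' 33 0 = v := by simp [← hσ', write_apply]
    have g29 : ∀ i < d.n, σ' 29 (i : ℕ) =
        if i = k then l else if i ∈ d.pre s t k then d.G else 0 := by
      intro i hi
      simp [← hσ', write_apply, h29 i hi]
    let J : ℕ → Mem → Prop := fun j τ => τ 28 0 = j ∧ ∀ i < j, τ 7 (i : ℕ) = σ' 29 (i : ℕ) ∧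
      τ 8 (i : ℕ) = d.G
    refine (Halts.forLoop (s := 3) J d.n hb ?_ ?_ ?_).mono le_rfl ?_
    · exact ⟨g28, fun i hi => absurd hi (Nat.not_lt_zero i)⟩
    · rintro j τ hf - ⟨k28, -⟩
      have h0 : τ 0 0 = d.n := by rw [hf 0 (by decide), ← hL'.n]
      rw [eval_sub, eval_reg, k28, nItems, eval_get, eval_const, h0]
      omega
    · rintro j τ hb hf hj ⟨k28, kJ⟩
      have h15 : τ 15 0 = d.G := by rw [hf 15 (by decide), ← hL'.G]
      refine Halts.setThen hb j (σ' 29 j) k28 ?_ ?_ fun hb => ?_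
      · rw [eval_get, eval_reg, k28, hf 29 (by decide)]
      · rw [← hf 29 (by decide)]
        exact hb 29 j
      refine Halts.setThen hb j d.G (by simpa [eval_reg, write_apply] using k28)
        (by simpa [eval_reg, write_apply] using h15) (hlG _ hd.G_pos.le le_rfl) fun hb => ?_
      refine Halts.regLast hb ((j + 1 : ℕ) : ℤ) ?_ ((hd.len_index (by omega)).trans (by omega)) ?_
      · simp [eval_add, eval_reg, eval_const, k28, write_apply]
      · refine ⟨by simp [write_apply], fun i hi => ?_⟩
        rcases Nat.lt_succ_iff_lt_or_eq.1 hi with hi | rfl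
        · simp [write_apply, hi.ne, kJ i hi]
        · simp [write_apply]
    · rintro τ - hf ⟨-, hJ⟩
      have k33 : τ 33 0 = v := by rw [hf 33 (by decide), g33]
      rw [k33]
      refine ⟨hlen, hlt.le, le_rfl, fun _ => ?_⟩
      exact solves_candidate (pre_subset s t k) hk (not_mem_pre s t k) hl0 hl1 hfeas
        (fun i hi => by rw [(hJ i hi).1, g29 i hi]) (fun i hi => (hJ i hi).2)
  · have hle : σ 33 0 ≤ v := by simpa [eval_sub, eval_reg, write_apply] using hg
    have h33' : RAM.write σ 32 0 v 33 0 = σ 33 0 := by simp [write_apply]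
    refine (Halts.skip (R := fun τ => len (τ 33 0) ≤ 5 * b ∧ τ 33 0 ≤ σ 33 0 ∧ τ 33 0 ≤ v ∧
      (τ 33 0 ≤ d.G * d.M → d.Solves τ (τ 33 0))) hb ?_).mono (by omega) fun _ _ _ h => h
    rw [h33']
    refine ⟨h33, le_rfl, hle, fun h => ?_⟩
    have h7 : RAM.write σ 32 0 v 7 = σ 7 := write_of_ne _ (by decide) _ _
    have h8 : RAM.write σ 32 0 v 8 = σ 8 := write_of_ne _ (by decide) _ _
    obtain ⟨a1, a2, a3, a4, a5⟩ := hsol h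
    exact ⟨by rwa [h7], by rwa [h7], by rwa [h8], by rwa [h7], by rwa [h7]⟩

end Search

namespace GridData

variable (d : GridData)

/-- The invariant of the search after the candidates with codes less than `m`: the value in
register `33` is at most that of every feasible one among them, and it is the value of the
solution in the output arrays unless it still has its initial value. -/
structure SearchInv (b m : ℕ) (σ : Mem) : Prop where
  code : σ 20 0 = m
  len_best : len (σ 33 0) ≤ 5 * b
  solves : σ 33 0 ≤ d.G * d.M → d.Solves σ (σ 33 0)
  best_le : ∀ m' < m, ∀ l, 0 ≤ l → l ≤ d.G → 0 ≤ d.slack (d.full m') (d.item m') l →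
    σ 33 0 ≤ d.value (d.full m') (d.item m') l

variable {d}

theorem Solves.frame {σ τ : Mem} {v : ℤ} (h : d.Solves σ v) (h7 : τ 7 = σ 7) (h8 : τ 8 = σ 8) :
    d.Solves τ v := by
  obtain ⟨a1, a2, a3, a4, a5⟩ := h
  exact ⟨by rwa [h7], by rwa [h7], by rwa [h8], by rwa [h7], by rwa [h7]⟩

theorem Tame.len_codes {b : ℕ} (hd : d.Tame b) : len (d.codes : ℤ) ≤ 5 * b := by
  have h1 := hd.len_index (i := d.n) (by omega)
  have h2 := hd.len_index (i := d.n + 3) le_rfl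
  have : (d.codes : ℤ) = (d.n : ℤ) * (((d.n + 3 : ℕ) : ℤ) * (((d.n + 3 : ℕ) : ℤ) *
      (((d.n + 3 : ℕ) : ℤ) * ((d.n + 3 : ℕ) : ℤ)))) := by
    simp only [codes]
    push_cast
    ring
  rw [this]
  exact (len_mul_le h1 (len_mul_le h2 (len_mul_le h2 (len_mul_le h2 h2)))).trans (by omega)

end GridData

namespace Search

open Expr Prog GridData

/-- Goes through all candidates. -/
def searchProg : Prog :=
  setReg 16 (nItems * ((nItems + const 3) * ((nItems + const 3) *
    ((nItems + const 3) * (nItems + const 3))))) ;;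
  setReg 33 (reg 15 * reg 14 + const 1) ;;
  setReg 20 (const 0) ;;
  loop (reg 16 - reg 20) candidateProg

variable {d : GridData} {b B : ℕ} {σ : Mem}

theorem candidateProg_halts (hd : d.Tame b) (hB : 20 * b ≤ B) (hb : Bounded B σ)
    (hσ : d.Loaded σ) {m : ℕ} (hm : m < d.codes) (hJ : d.SearchInv b m σ) :
    Halts B candidateProg (11 * d.n + 4 * b + 32) σ (d.SearchInv b (m + 1)) := by
  have hk : d.item m < d.n := Nat.mod_lt _ hd.n_pos
  have hS : d.full m ⊆ Finset.range d.n := pre_subset _ _ _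
  unfold candidateProg
  refine ((decodeProg_halts hd hB hb hσ hJ.code).seq
    (s' := (1 + (b * 4 + d.n * 4 + 11)) + (d.n * 7 + 5)) fun σ₁ hb hf₁ ⟨h21, h23, h24⟩ => ?_).mono
    (by omega) fun _ _ _ h => h
  have hσ₁ : d.Loaded σ₁ := hσ.frame hf₁ (by decide)
  refine (collectProg_halts hd hB hb hσ₁ hk h21 h23 h24).seq fun σ₂ hb hf₂ ⟨h25, h26, h27, h29⟩ => ?_
  have hσ₂ : d.Loaded σ₂ := hσ₁.frame hf₂ (by decide)
  have g21 : σ₂ 21 0 = d.item m := by rw [hf₂ 21 (by decide), h21]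
  have g20 : σ₂ 20 0 = m := by rw [hf₂ 20 (by decide), hf₁ 20 (by decide), hJ.code]
  have g33 : σ₂ 33 0 = σ 33 0 := by rw [hf₂ 33 (by decide), hf₁ 33 (by decide)]
  have g7 : σ₂ 7 = σ 7 := by rw [hf₂ 7 (by decide), hf₁ 7 (by decide)]
  have g8 : σ₂ 8 = σ 8 := by rw [hf₂ 8 (by decide), hf₁ 8 (by decide)]
  have hsol₂ : σ₂ 33 0 ≤ d.G * d.M → d.Solves σ₂ (σ₂ 33 0) := fun h => by
    rw [g33] at h ⊢
    exact (hJ.solves h).frame g7 g8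
  have hex : 0 < (slackExpr (reg 15)).eval σ₂ ↔ 0 ≤ d.slack (d.full m) (d.item m) d.G :=
    slackExpr_eval hσ₂ hk g21 h26 h27 hσ₂.G
  have key : Halts B (branch (slackExpr (reg 15)) (bisectProg ;; updateProg) skip)
      (b * 4 + d.n * 4 + 11) σ₂ fun τ => τ 20 0 = m ∧ len (τ 33 0) ≤ 5 * b ∧ τ 33 0 ≤ σ 33 0 ∧
      (τ 33 0 ≤ d.G * d.M → d.Solves τ (τ 33 0)) ∧
      ∀ l, 0 ≤ l → l ≤ d.G → 0 ≤ d.slack (d.full m) (d.item m) l →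
        τ 33 0 ≤ d.value (d.full m) (d.item m) l := by
    refine Halts.branch hb (fun hg => ?_) (fun hg => ?_)
    · have hfeas := hex.1 hg
      refine ((bisectProg_halts hd hB hb hσ₂ hS hk g21 h26 h27 hfeas).seq
        (s' := d.n * 4 + 6) fun σ₃ hb hf₃ ⟨i1, i2, i3, i4⟩ => ?_).mono (by omega) fun _ _ _ h => h
      have k33 : σ₃ 33 0 = σ₂ 33 0 := by rw [hf₃ 33 (by decide)]
      refine (updateProg_halts hd hB hb (hσ₂.frame hf₃ (by decide)) (s := d.dirX m) (t := d.dirY m)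
        hk (by rw [hf₃ 21 (by decide), g21]) (by rw [hf₃ 25 (by decide), h25])
        (by rw [hf₃ 29 (by decide)]; exact h29) (by rw [k33, g33]; exact hJ.len_best) rfl i1 i2 i3
        (fun h => by
          rw [k33] at h ⊢
          exact (hsol₂ h).frame (hf₃ 7 (by decide)) (hf₃ 8 (by decide)))).mono le_rfl ?_
      rintro τ - hf ⟨j1, j2, j3, j4⟩
      refine ⟨by rw [hf 20 (by decide), hf₃ 20 (by decide), g20], j1, by rw [k33, g33] at j2; exact j2,
        j4, fun l h0 h1 h2 => j3.trans ?_⟩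
      have := i4 l h0 h1 h2
      change (_ : ℤ) + _ ≤ _ + _
      exact Int.add_le_add_left this _
    · refine (Halts.skip (R := fun τ => τ = σ₂) hb rfl).mono (by omega) ?_
      rintro τ - - rfl
      refine ⟨g20, by rw [g33]; exact hJ.len_best, g33.le, hsol₂, fun l h0 h1 h2 => ?_⟩
      exact absurd (hex.2 (h2.trans (slack_mono hd hS hk h0 h1))) (not_lt.2 hg)
  refine key.seq fun τ hb _ ⟨j1, j2, j3, j4, j5⟩ => ?_
  have w33 : RAM.write τ 20 0 ((m + 1 : ℕ) : ℤ) 33 = τ 33 := write_of_ne _ (by decide) _ _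
  refine Halts.regLast hb ((m + 1 : ℕ) : ℤ) ?_ ?_ ⟨by simp [write_apply], ?_, ?_, ?_⟩
  · simp [eval_add, eval_reg, eval_const, j1]
  · exact (len_cast_mono (Nat.succ_le_of_lt hm)).trans (hd.len_codes.trans (by omega))
  · rwa [w33]
  · rw [w33]
    exact fun h => (j4 h).frame (write_of_ne _ (by decide) _ _) (write_of_ne _ (by decide) _ _)
  · rw [w33]
    intro m' hm' l h0 h1 h2
    rcases Nat.lt_succ_iff_lt_or_eq.1 hm' with h | rfl
    · exact j3.trans (hJ.best_le m' h l h0 h1 h2)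
    · exact j5 l h0 h1 h2

/-- The register for the best value starts with `G * M + 1`, which is more than the value of any
candidate. -/
theorem searchProg_halts (hd : d.Tame b) (hB : 20 * b ≤ B) (hb : Bounded B σ)
    (hσ : d.Loaded σ) :
    Halts B searchProg (d.codes * (11 * d.n + 4 * b + 33) + 4) σ (d.SearchInv b d.codes) := by
  have hz := len_zero_le hb
  have hlen : len (d.G * d.M + 1) ≤ 5 * b :=
    (len_add_le (len_mul_le hd.len_G hd.len_M) (by decide : len 1 ≤ 2)).trans
      (by have := (one_le_len _).trans hd.len_G; omega)
  unfold searchProg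
  refine Halts.regThen hb (d.codes : ℤ) ?_ (hd.len_codes.trans (by omega)) fun hb => ?_
  · simp only [eval_mul, eval_add, eval_const, nItems, eval_get, hσ.n, codes]
    push_cast
    ring
  refine Halts.regThen hb (d.G * d.M + 1) ?_ (hlen.trans (by omega)) fun hb => ?_
  · simp [eval_add, eval_mul, eval_reg, eval_const, write_apply, hσ.G, hσ.M]
  refine Halts.regThen hb 0 rfl hz fun hb => ?_
  generalize hσ' : RAM.write (RAM.write (RAM.write σ 16 0 (d.codes : ℤ)) 33 0 (d.G * d.M + 1)) 20 0 0
    = σ' at *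
  have hL' : d.Loaded σ' := by
    rw [← hσ']
    refine Loaded.write (Loaded.write ?_ (by norm_num) _ _) (by norm_num) _ _
    obtain ⟨h1, h2, h3, h4, h5, h6, h7, h8, h9⟩ := hσ
    constructor <;> simpa [write_apply]
  refine Halts.forLoop (d.SearchInv b) d.codes hb ?_ ?_ ?_
  · refine ⟨by simp [← hσ', write_apply], by simpa [← hσ', write_apply] using hlen, fun h => ?_,
      fun m' h => absurd h (Nat.not_lt_zero _)⟩
    simp [← hσ', write_apply] at h
  · intro j τ hf _ hJ
    have h16 : τ 16 0 = d.codes := by rw [hf 16 (by decide), ← hσ']; simp [write_apply]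
    rw [eval_sub, eval_reg, eval_reg, h16, hJ.code]
    omega
  · exact fun j τ hb hf hj hJ => candidateProg_halts hd hB hb (hL'.frame hf (by decide)) hj hJ

end Search

/-! ### Clearing denominators -/

namespace MinCKP

variable (I : MinCKP) (N : ℕ)

/-- The product of the denominators of the entries of `c`, `p` and `q`. -/
def scale : ℤ := ∏ i ∈ Finset.range I.n, (I.input N 2 i * I.input N 4 i * I.input N 6 i)

/-- The numerators over the common denominator of the entries whose numerators and denominators are
in the arrays `A` and `A + 1`, with a further entry `1` at the index `e ≥ n`. -/
def scaled (A e i : ℕ) : ℤ :=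
  if i < I.n then I.input N A i * (I.scale N / I.input N (A + 1) i) else if i = e then 1 else 0

/-- One more than the sum of the squares of the first `j` entries of the scaled vectors. The squares
serve as bounds for the absolute values, for which there is no instruction. -/
def squareSum (j : ℕ) : ℤ :=
  1 + ∑ i ∈ Finset.range j, (I.scaled N 1 I.n i * I.scaled N 1 I.n i +
    I.scaled N 3 (I.n + 1) i * I.scaled N 3 (I.n + 1) i +
    I.scaled N 5 (I.n + 2) i * I.scaled N 5 (I.n + 2) i)

/-- The integer data of an instance for the accuracy `1 / N`. The items `n`, `n + 1`, `n + 2` are the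
unit vectors that `exists_prefix` asks for, and one grid step of any item costs at most `1 / N`. -/
def gridData : GridData where
  n := I.n
  c := I.scaled N 1 I.n
  p := I.scaled N 3 (I.n + 1)
  q := I.scaled N 5 (I.n + 2)
  D := I.scale N
  M := I.squareSum N I.n
  G := N * I.squareSum N I.n
  Cn := I.C.num
  Cd := I.C.den

/-- A bound for the lengths of the input numbers. -/
def bits : ℕ := I.size + len N

theorem toArray_cast {n : ℕ} (v : Fin n → ℤ) {i : ℕ} (hi : i < n) : toArray v i = v ⟨i, hi⟩ := by
  simp [toArray, hi]

theorem len_toArray_le {n : ℕ} {v : Fin n → ℤ} {b : ℕ} (hb : 1 ≤ b) (hv : ∀ i, len (v i) ≤ b)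
    (i : ℤ) : len (toArray v i) ≤ b := by
  unfold toArray
  split_ifs
  · exact hv _
  · simpa [len] using hb

theorem abs_le_mul_self (z : ℤ) : |z| ≤ z * z := by
  rcases abs_cases z with ⟨h, h0⟩ | ⟨h, h0⟩ <;> rw [h] <;> nlinarith

section Size

variable {I}

theorem sum_item_le_size : ∑ i ∈ Finset.range I.n, (len (I.input N 1 i) + len (I.input N 2 i) +
    (len (I.input N 3 i) + len (I.input N 4 i)) + (len (I.input N 5 i) + len (I.input N 6 i))) +
    ratLen I.C = I.size := by
  rw [Finset.sum_range, size]
  congr 1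
  refine Finset.sum_congr rfl fun i _ => ?_
  simp only [input, toArray_cast _ i.2, ratLen]

theorem six_mul_n_add_four_le_size : 6 * I.n + 4 ≤ I.size := by
  rw [← sum_item_le_size 0]
  have h1 : I.n * 6 ≤ ∑ i ∈ Finset.range I.n, (len (I.input 0 1 i) + len (I.input 0 2 i) +
    (len (I.input 0 3 i) + len (I.input 0 4 i)) + (len (I.input 0 5 i) + len (I.input 0 6 i))) := by
    have := Finset.card_nsmul_le_sum (Finset.range I.n) (fun i : ℕ => len (I.input 0 1 i) +
      len (I.input 0 2 i) + (len (I.input 0 3 i) + len (I.input 0 4 i)) +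
      (len (I.input 0 5 i) + len (I.input 0 6 i))) 6 (fun i _ => by
        have := fun A => one_le_len (I.input 0 A i)
        have h1 := this 1
        have h2 := this 2
        have h3 := this 3
        have h4 := this 4
        have h5 := this 5
        have h6 := this 6
        show 6 ≤ len (I.input 0 1 i) +
          len (I.input 0 2 i) + (len (I.input 0 3 i) + len (I.input 0 4 i)) +
          (len (I.input 0 5 i) + len (I.input 0 6 i))
        omega)
    simpa using this
  have h2 : ∀ z : ℤ, 0 < z → 2 ≤ len z := fun z hz => by
    by_contra! h
    have : z.natAbs < 2 ^ 0 := len_le_iff.1 (by omega)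
    simp at this
    omega
  have h3 := h2 I.C.num (Rat.num_pos.2 I.C_pos)
  have h4 := h2 I.C.den (by exact_mod_cast I.C.den_pos)
  simp only [ratLen]
  omega

theorem len_input_le {A : ℕ} {i : ℤ} : len (I.input N A i) ≤ I.bits N := by
  have h4 := six_mul_n_add_four_le_size (I := I)
  have h1 : 1 ≤ I.bits N := by rw [bits]; omega
  have hC : ratLen I.C ≤ I.size := Nat.le_add_left _ _
  have hitem : ∀ i : Fin I.n, ratLen (I.c i) + ratLen (I.p i) + ratLen (I.q i) ≤ I.size := fun i =>
    (Finset.single_le_sum (f := fun i => ratLen (I.c i) + ratLen (I.p i) + ratLen (I.q i))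
      (fun _ _ => Nat.zero_le _) (Finset.mem_univ i)).trans (Nat.le_add_right _ _)
  have hn := len_natCast_le I.n
  unfold input
  split
  · refine len_toArray_le h1 (fun j => ?_) _
    simp only [ratLen, bits] at *
    fin_cases j
    · show len (I.n : ℤ) ≤ _
      omega
    · show len I.C.num ≤ _
      omega
    · show len (I.C.den : ℤ) ≤ _
      omega
    · show len (N : ℤ) ≤ _
      omega
  case h_8 => simpa [len] using h1
  all_goals
    refine len_toArray_le h1 (fun j => ?_) _
    have := hitem j
    simp only [ratLen, bits] at *
    omega

theorem bounded_input {B : ℕ} (hB : I.bits N ≤ B) : Bounded B (I.input N) :=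
  fun _ _ => (len_input_le N).trans hB

theorem len_partial_scale_le {j : ℕ} (hj : j ≤ I.n) :
    len (∏ i ∈ Finset.range j, (I.input N 2 i * I.input N 4 i * I.input N 6 i)) ≤
      I.size + 2 := by
  refine (len_prod_le _ _).trans ?_
  rw [add_comm]
  gcongr
  calc ∑ i ∈ Finset.range j, len (I.input N 2 i * I.input N 4 i * I.input N 6 i)
      ≤ ∑ i ∈ Finset.range I.n, len (I.input N 2 i * I.input N 4 i * I.input N 6 i) :=
        Finset.sum_le_sum_of_subset (Finset.range_subset_range.2 hj)
    _ ≤ ∑ i ∈ Finset.range I.n, (len (I.input N 1 i) + len (I.input N 2 i) +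
          (len (I.input N 3 i) + len (I.input N 4 i)) +
          (len (I.input N 5 i) + len (I.input N 6 i))) := by
        refine Finset.sum_le_sum fun i _ => ?_
        refine (len_mul_le (len_mul_le le_rfl le_rfl) le_rfl).trans ?_
        omega
    _ ≤ I.size := by rw [← sum_item_le_size N]; omega

theorem len_scaled_le (A e i : ℕ) : len (I.scaled N A e i) ≤ 3 * I.bits N := by
  have h4 := six_mul_n_add_four_le_size (I := I)
  have hb : I.size ≤ I.bits N := Nat.le_add_right _ _
  unfold scaled
  split_ifs
  · refine (len_mul_le (len_input_le N) (len_div_le _ (len_partial_scale_le N le_rfl))).trans ?_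
    omega
  · have : len 1 = 2 := by decide
    omega
  · have : len 0 = 1 := by decide
    omega

theorem squareSum_mono {j k : ℕ} (h : j ≤ k) : I.squareSum N j ≤ I.squareSum N k := by
  have := Finset.sum_le_sum_of_subset_of_nonneg (Finset.range_subset_range.2 h)
    (f := fun i => I.scaled N 1 I.n i * I.scaled N 1 I.n i +
      I.scaled N 3 (I.n + 1) i * I.scaled N 3 (I.n + 1) i +
      I.scaled N 5 (I.n + 2) i * I.scaled N 5 (I.n + 2) i) fun i _ _ =>
      add_nonneg (add_nonneg (mul_self_nonneg _) (mul_self_nonneg _)) (mul_self_nonneg _)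
  exact add_le_add le_rfl this

theorem one_le_squareSum (j : ℕ) : 1 ≤ I.squareSum N j :=
  (by simp [squareSum] : (1 : ℤ) = I.squareSum N 0).le.trans (squareSum_mono N (Nat.zero_le j))

theorem len_squareSum_le {j : ℕ} (hj : j ≤ I.n) : len (I.squareSum N j) ≤ 20 * I.bits N ^ 2 := by
  have h4 := six_mul_n_add_four_le_size (I := I)
  have hb : I.size ≤ I.bits N := Nat.le_add_right _ _
  have h1 : ∑ i ∈ Finset.range j, len (I.scaled N 1 I.n i * I.scaled N 1 I.n i +
      I.scaled N 3 (I.n + 1) i * I.scaled N 3 (I.n + 1) i +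
      I.scaled N 5 (I.n + 2) i * I.scaled N 5 (I.n + 2) i) ≤ j * (18 * I.bits N) := by
    have hl := len_scaled_le (I := I) N
    have := Finset.sum_le_card_nsmul (Finset.range j) (fun i => len (I.scaled N 1 I.n i * I.scaled N 1 I.n i +
      I.scaled N 3 (I.n + 1) i * I.scaled N 3 (I.n + 1) i +
      I.scaled N 5 (I.n + 2) i * I.scaled N 5 (I.n + 2) i)) (18 * I.bits N) (fun i _ =>
        (len_add_le (len_add_le (len_mul_le (hl 1 _ i) (hl 1 _ i)) (len_mul_le (hl 3 _ i) (hl 3 _ i)))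
          (len_mul_le (hl 5 _ i) (hl 5 _ i))).trans (by omega))
    simpa using this
  have h2 : j * (18 * I.bits N) ≤ I.bits N * (18 * I.bits N) := by gcongr; omega
  refine (len_add_le (by decide : len 1 ≤ 2) ((len_sum_le _ _).trans
    (Nat.add_le_add_left h1 1))).trans ?_
  nlinarith

theorem input_den_pos {A : ℕ} (hA : A = 2 ∨ A = 4 ∨ A = 6) {i : ℕ} (hi : i < I.n) :
    0 < I.input N A i := by
  rcases hA with rfl | rfl | rfl <;> simp only [input, toArray_cast _ hi] <;>
    exact_mod_cast Rat.den_pos _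

theorem scale_pos : 0 < I.scale N :=
  Finset.prod_pos fun i hi => by
    have hi := Finset.mem_range.1 hi
    exact mul_pos (mul_pos (input_den_pos N (by simp) hi) (input_den_pos N (by simp) hi))
      (input_den_pos N (by simp) hi)

theorem den_dvd_scale {A : ℕ} (hA : A = 2 ∨ A = 4 ∨ A = 6) {i : ℕ} (hi : i < I.n) :
    I.input N A i ∣ I.scale N := by
  refine Dvd.dvd.trans ?_ (Finset.dvd_prod_of_mem _ (Finset.mem_range.2 hi))
  rcases hA with rfl | rfl | rfl
  · exact Dvd.intro _ (mul_assoc _ _ _).symm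
  · exact (Dvd.intro_left _ rfl).mul_right _
  · exact Dvd.intro_left _ rfl

theorem scaled_eq {A e i : ℕ} (hA : A = 1 ∨ A = 3 ∨ A = 5) (hi : i < I.n) :
    (I.scaled N A e i : ℚ) = I.input N A i / I.input N (A + 1) i * I.scale N := by
  have hA' : A + 1 = 2 ∨ A + 1 = 4 ∨ A + 1 = 6 := by omega
  have hpos := input_den_pos N hA' hi
  have hne : (I.input N (A + 1) i : ℚ) ≠ 0 := by exact_mod_cast hpos.ne'
  rw [scaled, if_pos hi, Int.cast_mul, Int.cast_div (den_dvd_scale N hA' hi) hne]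
  ring

theorem scaled_c {e i : ℕ} (hi : i < I.n) : (I.scaled N 1 e i : ℚ) = I.c ⟨i, hi⟩ * I.scale N := by
  rw [scaled_eq N (by simp) hi]
  simp only [input, toArray_cast _ hi, Int.cast_natCast, Rat.num_div_den]

theorem scaled_p {e i : ℕ} (hi : i < I.n) : (I.scaled N 3 e i : ℚ) = I.p ⟨i, hi⟩ * I.scale N := by
  rw [scaled_eq N (by simp) hi]
  simp only [input, toArray_cast _ hi, Int.cast_natCast, Rat.num_div_den]

theorem scaled_q {e i : ℕ} (hi : i < I.n) : (I.scaled N 5 e i : ℚ) = I.q ⟨i, hi⟩ * I.scale N := by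
  rw [scaled_eq N (by simp) hi]
  simp only [input, toArray_cast _ hi, Int.cast_natCast, Rat.num_div_den]

theorem tame_gridData (hn : 0 < I.n) (hN : 0 < N) :
    (I.gridData N).Tame (30 * I.bits N ^ 2) := by
  have h4 := six_mul_n_add_four_le_size (I := I)
  have hb : I.size ≤ I.bits N := Nat.le_add_right _ _
  have hlN : len N ≤ I.bits N := Nat.le_add_left _ _
  have hsq : 4 * I.bits N ≤ I.bits N ^ 2 := by nlinarith
  have hscale : (0 : ℚ) ≤ I.scale N := by exact_mod_cast (scale_pos N).le
  have hle : ∀ f : ℕ → ℤ, (∀ i, f i * f i ≤ I.scaled N 1 I.n i * I.scaled N 1 I.n i +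
      I.scaled N 3 (I.n + 1) i * I.scaled N 3 (I.n + 1) i +
      I.scaled N 5 (I.n + 2) i * I.scaled N 5 (I.n + 2) i) →
      ∑ i ∈ Finset.range I.n, |f i| ≤ I.squareSum N I.n := by
    intro f hf
    have h1 := Finset.sum_le_sum (s := Finset.range I.n) fun i _ => (abs_le_mul_self (f i)).trans (hf i)
    rw [squareSum]
    omega
  have hn0 := fun A e i => mul_self_nonneg (I.scaled N A e i)
  constructor
  · exact hn
  · intro i hi
    have : (0 : ℚ) ≤ I.scaled N 3 (I.n + 1) i := by
      rw [scaled_p N hi]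
      exact mul_nonneg (I.p_nonneg _) hscale
    exact_mod_cast this
  · intro i hi
    have : (0 : ℚ) ≤ I.scaled N 5 (I.n + 2) i := by
      rw [scaled_q N hi]
      exact mul_nonneg (I.q_nonneg _) hscale
    exact_mod_cast this
  · exact mul_pos (by exact_mod_cast hN) (one_le_squareSum N I.n)
  · show (0 : ℤ) < (I.C.den : ℤ)
    exact_mod_cast I.C.den_pos
  · exact hle (I.scaled N 1 I.n) fun i => by linarith [hn0 3 (I.n + 1) i, hn0 5 (I.n + 2) i]
  · exact hle (I.scaled N 3 (I.n + 1)) fun i => by linarith [hn0 1 I.n i, hn0 5 (I.n + 2) i]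
  · exact hle (I.scaled N 5 (I.n + 2)) fun i => by linarith [hn0 1 I.n i, hn0 3 (I.n + 1) i]
  · refine (len_add_le (len_natCast_le I.n) (by decide : len 3 ≤ 3)).trans ?_
    omega
  · exact fun i _ => (len_scaled_le N _ _ i).trans (by omega)
  · exact fun i _ => (len_scaled_le N _ _ i).trans (by omega)
  · exact fun i _ => (len_scaled_le N _ _ i).trans (by omega)
  · exact (len_squareSum_le N le_rfl).trans (by omega)
  · exact (len_mul_le hlN (len_squareSum_le N le_rfl)).trans (by omega)

end Size

end MinCKP

namespace Search

open Expr Prog GridData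

/-- Computes the common denominator in register `13`. -/
def denominatorProg : Prog :=
  setReg 13 (const 1) ;; setReg 28 (const 0) ;;
  loop (nItems - reg 28)
    (setReg 13 (reg 13 * (get 2 (reg 28) * get 4 (reg 28) * get 6 (reg 28))) ;;
      setReg 28 (reg 28 + const 1))

/-- Computes the scaled vectors in the arrays `10`, `11`, `12`, and one more than the sum of the
squares of their entries in register `14`. -/
def scaleProg : Prog :=
  setReg 14 (const 1) ;; setReg 28 (const 0) ;;
  loop (nItems - reg 28)
    (set 10 (reg 28) (get 1 (reg 28) * (reg 13 / get 2 (reg 28))) ;;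
      set 11 (reg 28) (get 3 (reg 28) * (reg 13 / get 4 (reg 28))) ;;
      set 12 (reg 28) (get 5 (reg 28) * (reg 13 / get 6 (reg 28))) ;;
      setReg 14 (reg 14 + (get 10 (reg 28) * get 10 (reg 28) + get 11 (reg 28) * get 11 (reg 28) +
        get 12 (reg 28) * get 12 (reg 28))) ;;
      setReg 28 (reg 28 + const 1))

/-- Appends three unit vectors to the scaled data and computes the number of grid steps. -/
def padProg : Prog :=
  set 10 nItems (const 1) ;; set 11 (nItems + const 1) (const 1) ;;
  set 12 (nItems + const 2) (const 1) ;; setReg 15 (get 0 (const 3) * reg 14)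

/-- The program that solves the relaxation. -/
def solveProg : Prog := denominatorProg ;; scaleProg ;; padProg ;; searchProg

variable {I : MinCKP} {N B : ℕ} {σ : Mem}

theorem input_zero_zero : I.input N 0 0 = I.n := by simp [MinCKP.input, MinCKP.toArray]

theorem denominatorProg_halts (hB : 20 * (30 * I.bits N ^ 2) ≤ B) :
    Halts B denominatorProg (I.n * 3 + 3) (I.input N) fun τ => τ 13 0 = I.scale N := by
  have h4 := MinCKP.six_mul_n_add_four_le_size (I := I)
  have hbits : I.size ≤ I.bits N := Nat.le_add_right _ _
  have hsq : 4 * I.bits N ≤ I.bits N ^ 2 := by nlinarith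
  have hb := MinCKP.bounded_input (I := I) (B := B) N (by omega)
  unfold denominatorProg
  refine Halts.regThen hb 1 rfl ?_ fun hb => Halts.regThen hb 0 rfl (len_zero_le hb) fun hb => ?_
  · have : len 1 = 2 := by decide
    omega
  let J : ℕ → Mem → Prop := fun j τ => τ 28 0 = j ∧
    τ 13 0 = ∏ i ∈ Finset.range j, (I.input N 2 i * I.input N 4 i * I.input N 6 i)
  refine (Halts.forLoop (s := 2) J I.n hb ?_ ?_ ?_).mono le_rfl fun τ _ _ h => h.2
  · simp [J, write_apply]
  · rintro j τ hf - ⟨h28, -⟩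
    have h0 : τ 0 0 = I.n := by rw [hf 0 (by decide), ← input_zero_zero (N := N)]; rfl
    rw [eval_sub, eval_reg, h28, nItems, eval_get, eval_const, h0]
    omega
  · rintro j τ hb hf hj ⟨h28, h13⟩
    have g2 : τ 2 = I.input N 2 := by rw [hf 2 (by decide)]; rfl
    have g4 : τ 4 = I.input N 4 := by rw [hf 4 (by decide)]; rfl
    have g6 : τ 6 = I.input N 6 := by rw [hf 6 (by decide)]; rfl
    refine Halts.regThen hb _ ?_
      ((MinCKP.len_partial_scale_le (I := I) (j := j + 1) N hj).trans (by omega)) fun hb => ?_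
    · simp only [eval_mul, eval_reg, eval_get, h28, h13, g2, g4, g6, Finset.prod_range_succ]
    refine Halts.regLast hb ((j + 1 : ℕ) : ℤ) ?_ ((len_natCast_le _).trans (by omega)) ?_
    · simp [eval_add, eval_reg, eval_const, h28, write_apply]
    · exact ⟨by simp [write_apply], by simp [write_apply]⟩

theorem scaleProg_halts (hB : 20 * (30 * I.bits N ^ 2) ≤ B) (hb : Bounded B σ)
    (hσ : ∀ A, A ∉ denominatorProg.targets → σ A = I.input N A) (h13 : σ 13 0 = I.scale N) :
    Halts B scaleProg (I.n * 6 + 3) σ fun τ => τ 14 0 = I.squareSum N I.n ∧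
      ∀ i : ℕ, τ 10 i = (if i < I.n then I.scaled N 1 I.n i else 0) ∧
        τ 11 i = (if i < I.n then I.scaled N 3 (I.n + 1) i else 0) ∧
        τ 12 i = (if i < I.n then I.scaled N 5 (I.n + 2) i else 0) := by
  have h4 := MinCKP.six_mul_n_add_four_le_size (I := I)
  have hbits : I.size ≤ I.bits N := Nat.le_add_right _ _
  have hsq : 4 * I.bits N ≤ I.bits N ^ 2 := by nlinarith
  unfold scaleProg
  refine Halts.regThen hb 1 rfl ?_ fun hb => Halts.regThen hb 0 rfl (len_zero_le hb) fun hb => ?_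
  · have : len 1 = 2 := by decide
    omega
  let J : ℕ → Mem → Prop := fun j τ => τ 28 0 = j ∧ τ 14 0 = I.squareSum N j ∧
      ∀ i : ℕ, τ 10 i = (if i < j then I.scaled N 1 I.n i else 0) ∧
        τ 11 i = (if i < j then I.scaled N 3 (I.n + 1) i else 0) ∧
        τ 12 i = (if i < j then I.scaled N 5 (I.n + 2) i else 0)
  refine (Halts.forLoop (s := 5) J I.n hb ?_ ?_ ?_).mono le_rfl fun τ _ _ h => h.2
  · refine ⟨by simp [write_apply], by simp [write_apply, MinCKP.squareSum], fun i => ?_⟩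
    simp only [write_apply]
    norm_num
    rw [hσ 10 (by decide), hσ 11 (by decide), hσ 12 (by decide)]
    exact ⟨rfl, rfl, rfl⟩
  · rintro j τ hf - ⟨h28, -⟩
    have h0 : τ 0 0 = I.n := by
      rw [hf 0 (by decide), write_of_ne _ (by decide), write_of_ne _ (by decide),
        hσ 0 (by decide), input_zero_zero]
    rw [eval_sub, eval_reg, h28, nItems, eval_get, eval_const, h0]
    omega
  · rintro j τ hb hf hj ⟨h28, h14, hJ⟩
    have g : ∀ A, A ∈ [1, 2, 3, 4, 5, 6] → τ A = I.input N A := fun A hA => by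
      fin_cases hA <;>
      rw [hf _ (by decide), write_of_ne _ (by decide), write_of_ne _ (by decide), hσ _ (by decide)]
    have g13 : τ 13 0 = I.scale N := by
      rw [hf 13 (by decide), write_of_ne _ (by decide), write_of_ne _ (by decide), h13]
    have hl : ∀ A e, len (I.scaled N A e j) ≤ B := fun A e =>
      (MinCKP.len_scaled_le N A e j).trans (by omega)
    refine Halts.setThen hb j (I.scaled N 1 I.n j) h28 ?_ (hl _ _) fun hb => ?_
    · simp [eval_mul, eval_div, eval_reg, eval_get, h28, g13, g, MinCKP.scaled, hj]
    refine Halts.setThen hb j (I.scaled N 3 (I.n + 1) j) (by simpa [eval_reg, write_apply] using h28)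
      ?_ (hl _ _) fun hb => ?_
    · simp [eval_mul, eval_div, eval_reg, eval_get, h28, g13, g, MinCKP.scaled, hj, write_apply]
    refine Halts.setThen hb j (I.scaled N 5 (I.n + 2) j) (by simpa [eval_reg, write_apply] using h28)
      ?_ (hl _ _) fun hb => ?_
    · simp [eval_mul, eval_div, eval_reg, eval_get, h28, g13, g, MinCKP.scaled, hj, write_apply]
    refine Halts.regThen hb (I.squareSum N (j + 1)) ?_
      ((MinCKP.len_squareSum_le N hj).trans (by omega)) fun hb => ?_
    · simp [eval_add, eval_mul, eval_reg, eval_get, h28, h14, write_apply, MinCKP.squareSum,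
        Finset.sum_range_succ, add_assoc]
    refine Halts.regLast hb ((j + 1 : ℕ) : ℤ) ?_ ((len_natCast_le _).trans (by omega)) ?_
    · simp [eval_add, eval_reg, eval_const, h28, write_apply]
    · refine ⟨by simp [write_apply], by simp [write_apply], fun i => ?_⟩
      obtain ⟨k1, k2, k3⟩ := hJ i
      rcases eq_or_ne i j with rfl | hij
      · simp [write_apply]
      · have : i < j + 1 ↔ i < j := by omega
        simp [write_apply, hij, k1, k2, k3, this]

theorem padProg_halts (hn : 0 < I.n) (hN : 0 < N) (hB : 20 * (30 * I.bits N ^ 2) ≤ B)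
    (hb : Bounded B σ) (h0 : σ 0 = I.input N 0) (h13 : σ 13 0 = I.scale N)
    (h14 : σ 14 0 = I.squareSum N I.n)
    (h : ∀ i : ℕ, σ 10 i = (if i < I.n then I.scaled N 1 I.n i else 0) ∧
        σ 11 i = (if i < I.n then I.scaled N 3 (I.n + 1) i else 0) ∧
        σ 12 i = (if i < I.n then I.scaled N 5 (I.n + 2) i else 0)) :
    Halts B padProg 4 σ (I.gridData N).Loaded := by
  have h4 := MinCKP.six_mul_n_add_four_le_size (I := I)
  have hbits : I.size ≤ I.bits N := Nat.le_add_right _ _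
  have hsq : 4 * I.bits N ≤ I.bits N ^ 2 := by nlinarith
  have h1 : len 1 ≤ B := by
    have : len 1 = 2 := by decide
    omega
  have hn0 : σ 0 0 = I.n := by rw [h0, input_zero_zero]
  have hd := MinCKP.tame_gridData (I := I) N hn hN
  unfold padProg
  refine Halts.setThen hb I.n 1 hn0 rfl h1 fun hb => ?_
  refine Halts.setThen hb ((I.n + 1 : ℕ) : ℤ) 1 ?_ rfl h1 fun hb => ?_
  · simp [eval_add, nItems, eval_get, eval_const, write_apply, hn0]
  refine Halts.setThen hb ((I.n + 2 : ℕ) : ℤ) 1 ?_ rfl h1 fun hb => ?_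
  · simp [eval_add, nItems, eval_get, eval_const, write_apply, hn0]
  refine Halts.regLast hb (I.gridData N).G ?_ (hd.len_G.trans (by omega)) ?_
  · simp only [eval_mul, eval_get, eval_reg, eval_const, write_apply]
    norm_num
    rw [h0, h14]
    simp [MinCKP.input, MinCKP.toArray, MinCKP.gridData]
  constructor
  · simp [write_apply, hn0, MinCKP.gridData]
  · simp [write_apply, h0, MinCKP.input, MinCKP.toArray, MinCKP.gridData]
  · simp [write_apply, h0, MinCKP.input, MinCKP.toArray, MinCKP.gridData]
  · intro i _
    simp only [write_apply, (h i).1, MinCKP.gridData, MinCKP.scaled]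
    norm_num
    split_ifs <;> first | rfl | omega
  · intro i _
    simp only [write_apply, (h i).2.1, MinCKP.gridData, MinCKP.scaled]
    norm_num
    split_ifs <;> first | rfl | omega
  · intro i _
    simp only [write_apply, (h i).2.2, MinCKP.gridData, MinCKP.scaled]
    norm_num
    split_ifs <;> first | rfl | omega
  · simp [write_apply, h13, MinCKP.gridData]
  · simp [write_apply, h14, MinCKP.gridData]
  · simp [write_apply]

theorem solveProg_halts (hn : 0 < I.n) (hN : 0 < N) (hB : 20 * (30 * I.bits N ^ 2) ≤ B) :
    Halts B solveProg ((I.gridData N).codes * (11 * I.n + 120 * I.bits N ^ 2 + 33) + 9 * I.n + 14)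
      (I.input N) ((I.gridData N).SearchInv (30 * I.bits N ^ 2) (I.gridData N).codes) := by
  have hd := MinCKP.tame_gridData (I := I) N hn hN
  unfold solveProg
  refine ((denominatorProg_halts hB).seq (s' := (((I.gridData N).codes * (11 * I.n +
    4 * (30 * I.bits N ^ 2) + 33) + 4) + 4) + (I.n * 6 + 3)) fun σ₁ hb hf₁ h13 => ?_).mono ?_
    fun _ _ _ h => h
  · refine (scaleProg_halts hB hb hf₁ h13).seq fun σ₂ hb hf₂ ⟨h14, harr⟩ => ?_
    refine (padProg_halts hn hN hB hb ?_ ?_ h14 harr).seq fun σ₃ hb _ h => ?_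
    · rw [hf₂ 0 (by decide), hf₁ 0 (by decide)]
    · rw [hf₂ 13 (by decide), h13]
    · exact searchProg_halts hd hB hb h
  · rw [show 4 * (30 * I.bits N ^ 2) = 120 * I.bits N ^ 2 by ring]
    omega

end Search

/-! ### Correctness and running time -/

namespace MinCKP

variable {I : MinCKP}

theorem exists_isOptimal (h : I.C ≤ (∑ i, I.p i) ^ 2 + (∑ i, I.q i) ^ 2) :
    ∃ x, I.IsOptimal x := by
  have hobj : Continuous I.objective := by unfold objective; fun_prop
  have hpow : Continuous I.power := by unfold power; fun_prop
  have hset : {x | I.IsFeasible x} =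
      (Set.univ.pi fun _ : Fin I.n => Set.Icc (0 : ℝ) 1) ∩ {x | (I.C : ℝ) ≤ I.power x} := by
    ext x
    simp only [IsFeasible, Set.mem_inter_iff, Set.mem_univ_pi, Set.mem_ofPred_eq]
  have hc : IsCompact {x | I.IsFeasible x} := by
    rw [hset]
    exact (isCompact_univ_pi fun _ => isCompact_Icc).inter_right (isClosed_le continuous_const hpow)
  obtain ⟨x, hx, hmin⟩ := hc.exists_isMinOn ⟨fun _ => 1, by
    refine ⟨fun _ => by simp, ?_⟩
    simp only [power, mul_one]
    exact_mod_cast h⟩ hobj.continuousOn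
  exact ⟨x, hx, fun y hy => hmin hy⟩

theorem n_pos (h : I.C ≤ (∑ i, I.p i) ^ 2 + (∑ i, I.q i) ^ 2) : 0 < I.n := by
  by_contra hn
  have : IsEmpty (Fin I.n) := by
    rw [Nat.eq_zero_of_not_pos hn]
    infer_instance
  simp at h
  exact absurd I.C_pos (not_lt.2 h)

end MinCKP

namespace GridData

variable {d : GridData}

theorem value_le {b : ℕ} (hd : d.Tame b) {S : Finset ℕ} (hS : S ⊆ Finset.range d.n) {k : ℕ}
    (hk : k < d.n) (hkS : k ∉ S) {l : ℤ} (hl0 : 0 ≤ l) (hl1 : l ≤ d.G) :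
    d.value S k l ≤ d.G * d.M := by
  rw [value, ← sum_candidate hS hk hkS]
  calc ∑ i ∈ Finset.range d.n, d.c i * (if i = k then l else if i ∈ S then d.G else 0)
      ≤ ∑ i ∈ Finset.range d.n, d.G * |d.c i| := by
        refine Finset.sum_le_sum fun i _ => (mul_le_mul_of_nonneg_right (le_abs_self _) ?_).trans ?_
        · split_ifs
          exacts [hl0, hd.G_pos.le, le_rfl]
        · rw [mul_comm]
          refine mul_le_mul_of_nonneg_right ?_ (abs_nonneg _)
          split_ifs
          exacts [hl1, le_rfl, hd.G_pos.le]
    _ = d.G * ∑ i ∈ Finset.range d.n, |d.c i| := (Finset.mul_sum _ _ _).symm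
    _ ≤ d.G * d.M := mul_le_mul_of_nonneg_left hd.sum_c hd.G_pos.le

theorem before_iff {s t : ℤ} {k i : ℕ} (hk : k < d.n) (hi : i < d.n) :
    d.Before s t k i ↔ Precedes (fun i => (d.c i : ℝ)) (fun i => (d.p i : ℝ))
      (fun i => (d.q i : ℝ)) ((s : ℝ), (t : ℝ)) i k := by
  simp only [Precedes, dirGap, dirWeight, Before]
  norm_cast
  generalize d.c k * (s * d.p i + t * d.q i) - d.c i * (s * d.p k + t * d.q k) = E
  rcases lt_trichotomy E 0 with h | h | h
  · constructor
    · intro h'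
      nlinarith
    · rintro (h' | h') <;> omega
  · subst h
    simp
  · refine ⟨fun _ => Or.inl h, fun _ => ?_⟩
    nlinarith

open Classical in
/-- For every fractional solution, the search meets a feasible candidate on the grid that costs
at most the rounding error `M` more (in scaled units). -/
theorem exists_candidate {b : ℕ} (hd : d.Tame b)
    (hcn : d.c d.n = 1) (hpn : d.p d.n = 0) (hqn : d.q d.n = 0)
    (hcn1 : d.c (d.n + 1) = 0) (hpn1 : d.p (d.n + 1) = 1) (hqn1 : d.q (d.n + 1) = 0)
    (hcn2 : d.c (d.n + 2) = 0) (hpn2 : d.p (d.n + 2) = 0) (hqn2 : d.q (d.n + 2) = 1)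
    (x : ℕ → ℝ) (hx0 : ∀ i < d.n, 0 ≤ x i) (hx1 : ∀ i < d.n, x i ≤ 1)
    (hpos : 0 < (∑ i ∈ Finset.range d.n, (d.p i : ℝ) * x i) ^ 2 +
      (∑ i ∈ Finset.range d.n, (d.q i : ℝ) * x i) ^ 2)
    (hfeas : (d.Cn : ℝ) * d.D ^ 2 ≤ ((∑ i ∈ Finset.range d.n, (d.p i : ℝ) * x i) ^ 2 +
      (∑ i ∈ Finset.range d.n, (d.q i : ℝ) * x i) ^ 2) * d.Cd) :
    ∃ m < d.codes, ∃ l, 0 ≤ l ∧ l ≤ d.G ∧ 0 ≤ d.slack (d.full m) (d.item m) l ∧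
      (d.value (d.full m) (d.item m) l : ℝ) ≤
        d.G * (∑ i ∈ Finset.range d.n, (d.c i : ℝ) * x i) + d.M := by
  obtain ⟨i₁, hi₁, j₁, hj₁, i₂, hi₂, j₂, hj₂, k, hk, y, hy0, hy1, H⟩ :=
    exists_prefix (fun i => (d.c i : ℝ)) (fun i => (d.p i : ℝ)) (fun i => (d.q i : ℝ)) d.n
      (fun i hi => by exact_mod_cast hd.p_nonneg i hi) (fun i hi => by exact_mod_cast hd.q_nonneg i hi)
      (by simp [hcn]) (by simp [hpn]) (by simp [hqn]) (by simp [hcn1]) (by simp [hpn1])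
      (by simp [hqn1]) (by simp [hcn2]) (by simp [hpn2]) (by simp [hqn2]) x hx0 hx1 hpos
  obtain ⟨m, hm, rfl, rfl, rfl, rfl, rfl⟩ := exists_code hd.n_pos hi₁ hj₁ hi₂ hj₂ hk
  obtain ⟨hcost, hpow⟩ := H (d.full m) (by
    ext i
    simp only [full, pre, Finset.mem_filter, Finset.mem_range]
    refine and_congr_right fun hi => ?_
    rw [before_iff hk hi]
    simp [critDir, dirX, dirY])
  have hG : (0 : ℝ) < d.G := by exact_mod_cast hd.G_pos
  have hCd : (0 : ℝ) < d.Cd := by exact_mod_cast hd.Cd_pos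
  have hpk : (0 : ℝ) ≤ d.p (d.item m) := by exact_mod_cast hd.p_nonneg _ hk
  have hqk : (0 : ℝ) ≤ d.q (d.item m) := by exact_mod_cast hd.q_nonneg _ hk
  have hS : d.full m ⊆ Finset.range d.n := pre_subset _ _ _
  have hPS : (0 : ℝ) ≤ ∑ i ∈ d.full m, (d.p i : ℝ) := Finset.sum_nonneg fun i hi => by
    exact_mod_cast hd.p_nonneg i (Finset.mem_range.1 (hS hi))
  have hQS : (0 : ℝ) ≤ ∑ i ∈ d.full m, (d.q i : ℝ) := Finset.sum_nonneg fun i hi => by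
    exact_mod_cast hd.q_nonneg i (Finset.mem_range.1 (hS hi))
  have hcM : |(d.c (d.item m) : ℝ)| ≤ d.M := by
    have := (Finset.single_le_sum (f := fun i => |d.c i|) (fun i _ => abs_nonneg _)
      (Finset.mem_range.2 hk)).trans hd.sum_c
    exact_mod_cast this
  -- rounding up the fraction keeps the candidate feasible
  have key : ∀ l : ℤ, y * d.G ≤ l → 0 ≤ d.slack (d.full m) (d.item m) l := by
    intro l hl
    have hlow : 0 ≤ y * d.G := by positivity
    have h1 : (d.G : ℝ) * (∑ i ∈ d.full m, (d.p i : ℝ) + y * d.p (d.item m)) ≤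
        d.G * ∑ i ∈ d.full m, (d.p i : ℝ) + l * d.p (d.item m) := by nlinarith
    have h2 : (d.G : ℝ) * (∑ i ∈ d.full m, (d.q i : ℝ) + y * d.q (d.item m)) ≤
        d.G * ∑ i ∈ d.full m, (d.q i : ℝ) + l * d.q (d.item m) := by nlinarith
    have h3 := pow_le_pow_left₀ (by positivity) h1 2
    have h4 := pow_le_pow_left₀ (by positivity) h2 2
    have h5 := mul_le_mul_of_nonneg_right hpow hCd.le
    have h6 := mul_le_mul_of_nonneg_left (hfeas.trans h5) (sq_nonneg (d.G : ℝ))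
    have h7 := mul_le_mul_of_nonneg_right (add_le_add h3 h4) hCd.le
    have : (0 : ℝ) ≤ d.slack (d.full m) (d.item m) l := by
      simp only [slack]
      push_cast
      nlinarith
    exact_mod_cast this
  refine ⟨m, hm, ?_⟩
  have hcost' := mul_le_mul_of_nonneg_left hcost hG.le
  rcases lt_or_ge (d.c (d.item m)) 0 with hc | hc
  · have hc' : (d.c (d.item m) : ℝ) < 0 := by exact_mod_cast hc
    have hM : (0 : ℝ) ≤ d.M := (abs_nonneg _).trans hcM
    refine ⟨d.G, hd.G_pos.le, le_rfl, key _ (by nlinarith), ?_⟩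
    simp only [value]
    push_cast
    linarith [mul_nonneg (mul_nonneg (sub_nonneg.2 hy1) hG.le) (neg_nonneg.2 hc'.le)]
  · have hc' : (0 : ℝ) ≤ d.c (d.item m) := by exact_mod_cast hc
    refine ⟨⌈y * d.G⌉, Int.ceil_nonneg (by positivity), Int.ceil_le.2 (by nlinarith),
      key _ (Int.le_ceil _), ?_⟩
    have h1 := mul_le_mul_of_nonneg_right (Int.ceil_lt_add_one (y * (d.G : ℝ))).le hc'
    have h2 := (le_abs_self _).trans hcM
    simp only [value]
    push_cast
    linarith

end GridData

namespace MinCKP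

variable {I : MinCKP}

/-- The result of the search is a `δ`-optimal solution. -/
theorem isDeltaOptimal_of_search {N b : ℕ} {δ : ℝ} (hδ : 0 < δ) (hN : 1 / δ ≤ N) {σ : Mem}
    (h : I.C ≤ (∑ i, I.p i) ^ 2 + (∑ i, I.q i) ^ 2) (hd : (I.gridData N).Tame b)
    (hσ : (I.gridData N).SearchInv b (I.gridData N).codes σ) :
    ∃ x, I.IsOutput σ x ∧ I.IsDeltaOptimal δ x := by
  obtain ⟨xopt, hopt⟩ := exists_isOptimal h
  let y : ℕ → ℝ := fun i => if hi : i < I.n then xopt ⟨i, hi⟩ else 0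
  have hD : (0 : ℝ) < I.scale N := by exact_mod_cast scale_pos N
  have hD1 : (1 : ℝ) ≤ I.scale N := by exact_mod_cast scale_pos N
  have hcR : ∀ i (hi : i < I.n), ((I.gridData N).c i : ℝ) = I.c ⟨i, hi⟩ * I.scale N := fun i hi => by
    exact_mod_cast scaled_c N hi
  have hpR : ∀ i (hi : i < I.n), ((I.gridData N).p i : ℝ) = I.p ⟨i, hi⟩ * I.scale N := fun i hi => by
    exact_mod_cast scaled_p N hi
  have hqR : ∀ i (hi : i < I.n), ((I.gridData N).q i : ℝ) = I.q ⟨i, hi⟩ * I.scale N := fun i hi => by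
    exact_mod_cast scaled_q N hi
  -- scaled sums are sums over the instance
  have hsum : ∀ (f : ℕ → ℤ) (g : Fin I.n → ℚ) (u : ℕ → ℝ) (v : Fin I.n → ℝ) (r : ℝ),
      (∀ i (hi : i < I.n), (f i : ℝ) = g ⟨i, hi⟩ * I.scale N) →
      (∀ i (hi : i < I.n), u i = v ⟨i, hi⟩ * r) →
      ∑ i ∈ Finset.range I.n, (f i : ℝ) * u i = I.scale N * r * ∑ i, (g i : ℝ) * v i := by
    intro f g u v r hf hu
    rw [Finset.sum_range, Finset.mul_sum]
    refine Finset.sum_congr rfl fun i _ => ?_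
    rw [hf i i.2, hu i i.2]
    ring
  have hyx : ∀ i (hi : i < I.n), y i = xopt ⟨i, hi⟩ * 1 := fun i hi => by simp [y, hi]
  have hyc := hsum _ I.c y xopt 1 hcR hyx
  have hyp := hsum _ I.p y xopt 1 hpR hyx
  have hyq := hsum _ I.q y xopt 1 hqR hyx
  rw [mul_one] at hyc hyp hyq
  have hpow : (∑ i ∈ Finset.range I.n, ((I.gridData N).p i : ℝ) * y i) ^ 2 +
      (∑ i ∈ Finset.range I.n, ((I.gridData N).q i : ℝ) * y i) ^ 2 =
      (I.scale N : ℝ) ^ 2 * I.power xopt := by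
    rw [hyp, hyq, power]
    ring
  have hC : (0 : ℝ) < I.C := by exact_mod_cast I.C_pos
  have hCle := hopt.1.2
  have hCd : (0 : ℝ) < (I.C.den : ℝ) := by exact_mod_cast I.C.den_pos
  have hCeq : (I.C : ℝ) * I.C.den = I.C.num := by exact_mod_cast Rat.mul_den_eq_num I.C
  have hfeas : ((I.gridData N).Cn : ℝ) * (I.gridData N).D ^ 2 ≤
      ((∑ i ∈ Finset.range I.n, ((I.gridData N).p i : ℝ) * y i) ^ 2 +
      (∑ i ∈ Finset.range I.n, ((I.gridData N).q i : ℝ) * y i) ^ 2) * (I.gridData N).Cd := by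
    rw [hpow]
    change (I.C.num : ℝ) * (I.scale N : ℝ) ^ 2 ≤ _ * ((I.C.den : ℤ) : ℝ)
    rw [← hCeq, Int.cast_natCast]
    nlinarith [mul_le_mul_of_nonneg_right hCle (mul_pos hCd (pow_pos hD 2)).le]
  have hn1 : ¬ I.n + 1 < I.n := by omega
  have hn2 : ¬ I.n + 2 < I.n := by omega
  obtain ⟨m, hm, l, hl0, hl1, hslack, hval⟩ := GridData.exists_candidate hd
    (by simp [gridData, scaled]) (by simp [gridData, scaled]) (by simp [gridData, scaled])
    (by simp [gridData, scaled]) (by simp [gridData, scaled]) (by simp [gridData, scaled])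
    (by simp [gridData, scaled]) (by simp [gridData, scaled]) (by simp [gridData, scaled])
    y (fun i (hi : i < I.n) => by rw [hyx i hi, mul_one]; exact (hopt.1.1 _).1)
    (fun i (hi : i < I.n) => by rw [hyx i hi, mul_one]; exact (hopt.1.1 _).2)
    (by
      change 0 < (∑ i ∈ Finset.range I.n, ((I.gridData N).p i : ℝ) * y i) ^ 2 +
        (∑ i ∈ Finset.range I.n, ((I.gridData N).q i : ℝ) * y i) ^ 2
      rw [hpow]
      exact mul_pos (pow_pos hD 2) (hC.trans_le hCle)) hfeas
  have hbest := hσ.best_le m hm l hl0 hl1 hslack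
  obtain ⟨s1, s2, s3, s4, s5⟩ := hσ.solves (hbest.trans (GridData.value_le hd
    (GridData.pre_subset _ _ _) (Nat.mod_lt _ hd.n_pos) (GridData.not_mem_pre _ _ _) hl0 hl1))
  have hGpos := hd.G_pos
  have hG : (0 : ℝ) < (I.gridData N).G := by exact_mod_cast hGpos
  have hGQ : (0 : ℚ) < (I.gridData N).G := by exact_mod_cast hGpos
  let x : Fin I.n → ℚ := fun i => (σ 7 (i : ℕ) : ℚ) / ((I.gridData N).G : ℚ)
  have hx : ∀ i (hi : i < I.n), (σ 7 (i : ℕ) : ℝ) = (x ⟨i, hi⟩ : ℝ) * (I.gridData N).G := by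
    intro i hi
    simp only [x]
    push_cast
    rw [div_mul_cancel₀ _ hG.ne']
  have hxc := hsum _ I.c (fun i => (σ 7 (i : ℕ) : ℝ)) (fun i => (x i : ℝ)) _ hcR hx
  have hxp := hsum _ I.p (fun i => (σ 7 (i : ℕ) : ℝ)) (fun i => (x i : ℝ)) _ hpR hx
  have hxq := hsum _ I.q (fun i => (σ 7 (i : ℕ) : ℝ)) (fun i => (x i : ℝ)) _ hqR hx
  refine ⟨x, fun i => ⟨by rw [s3 i i.2]; exact hGpos, by rw [s3 i i.2]⟩, fun i => ⟨?_, ?_⟩,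
    ⟨xopt, hopt, ?_⟩, ?_⟩
  · exact div_nonneg (by exact_mod_cast s1 i i.2) hGQ.le
  · exact (div_le_one hGQ).2 (by exact_mod_cast s2 i i.2)
  · have hbestR : ((σ 33 0 : ℤ) : ℝ) ≤ _ := (Int.cast_le.2 hbest).trans hval
    have s4R : ∑ i ∈ Finset.range I.n, ((I.gridData N).c i : ℝ) * (σ 7 (i : ℕ) : ℝ) = σ 33 0 := by
      exact_mod_cast s4
    rw [← s4R, hxc] at hbestR
    change _ ≤ _ * (∑ i ∈ Finset.range I.n, ((I.gridData N).c i : ℝ) * y i) + _ at hbestR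
    rw [hyc] at hbestR
    change (I.scale N : ℝ) * (I.gridData N).G * I.objective (fun i => (x i : ℝ)) ≤
      (I.gridData N).G * (I.scale N * I.objective xopt) + (I.gridData N).M at hbestR
    have hGM : ((I.gridData N).G : ℝ) = N * (I.gridData N).M := by
      simp [gridData]
    have hM : (0 : ℝ) ≤ (I.gridData N).M := by
      exact_mod_cast (one_le_squareSum (I := I) N I.n).trans' zero_le_one
    have hNδ : 1 ≤ N * δ := by rwa [div_le_iff₀ hδ] at hN
    have h1 : ((I.gridData N).M : ℝ) ≤ I.scale N * (I.gridData N).G * δ := by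
      calc ((I.gridData N).M : ℝ) ≤ (I.gridData N).M * (N * δ) := le_mul_of_one_le_right hM hNδ
        _ = 1 * ((I.gridData N).G * δ) := by rw [hGM]; ring
        _ ≤ I.scale N * ((I.gridData N).G * δ) :=
          mul_le_mul_of_nonneg_right hD1 (mul_pos hG hδ).le
        _ = _ := by ring
    refine le_of_mul_le_mul_left ?_ (mul_pos hD hG)
    linarith
  · have s5R : (I.C.num : ℝ) * ((I.scale N * (I.gridData N).G) * (I.scale N * (I.gridData N).G)) ≤
        ((∑ i ∈ Finset.range I.n, ((I.gridData N).p i : ℝ) * (σ 7 (i : ℕ) : ℝ)) *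
        (∑ i ∈ Finset.range I.n, ((I.gridData N).p i : ℝ) * (σ 7 (i : ℕ) : ℝ)) +
        (∑ i ∈ Finset.range I.n, ((I.gridData N).q i : ℝ) * (σ 7 (i : ℕ) : ℝ)) *
        (∑ i ∈ Finset.range I.n, ((I.gridData N).q i : ℝ) * (σ 7 (i : ℕ) : ℝ))) * I.C.den := by
      exact_mod_cast s5
    rw [hxp, hxq, ← hCeq] at s5R
    have hpos : 0 < (I.C.den : ℝ) * ((I.scale N : ℝ) * (I.gridData N).G) ^ 2 := by positivity
    have : (I.C : ℝ) ≤ I.power (fun i => (x i : ℝ)) := by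
      refine le_of_mul_le_mul_left ?_ hpos
      rw [power]
      nlinarith
    linarith

/-- The length of the accuracy parameter is logarithmic in `1 / δ`. -/
theorem bits_le {δ : ℝ} (hδ : 0 < δ) :
    (I.bits ⌈1 / δ⌉₊ : ℝ) ≤ 2 * ((I.size : ℝ) + max 0 (Real.log (1 / δ))) := by
  set y := max 0 (Real.log (1 / δ)) with hy
  have hy0 : 0 ≤ y := le_max_left _ _
  have h4 : 4 ≤ I.size := by
    have := six_mul_n_add_four_le_size (I := I)
    omega
  have hδ' : 0 < 1 / δ := by positivity
  have hexp : 1 / δ ≤ Real.exp y := by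
    rw [← Real.log_le_iff_le_exp hδ']
    exact le_max_right _ _
  have hN : (⌈1 / δ⌉₊ : ℝ) ≤ 2 * Real.exp y := by
    have h1 := (Nat.ceil_lt_add_one hδ'.le).le
    have h2 := Real.one_le_exp hy0
    linarith
  have hNpos : 0 < ⌈1 / δ⌉₊ := Nat.ceil_pos.2 hδ'
  obtain ⟨s, hs⟩ : ∃ s, Nat.size ⌈1 / δ⌉₊ = s + 1 :=
    ⟨_, (Nat.succ_pred_eq_of_pos (Nat.size_pos.2 hNpos)).symm⟩
  have hpow : (2 : ℝ) ^ s ≤ 2 * Real.exp y := by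
    refine le_trans ?_ hN
    exact_mod_cast Nat.lt_size.1 (by omega : s < Nat.size ⌈1 / δ⌉₊)
  have hlog := Real.log_le_log (by positivity) hpow
  rw [Real.log_pow, Real.log_mul two_ne_zero (Real.exp_pos y).ne', Real.log_exp] at hlog
  have hl2 := Real.log_two_gt_d9
  have hs' : (s : ℝ) ≤ 1 + 2 * y := by
    by_contra! hlt
    nlinarith
  have hlen : len (⌈1 / δ⌉₊ : ℤ) = s + 2 := by
    rw [len, Int.natAbs_natCast, hs]
  rw [bits, hlen]
  push_cast
  have : (4 : ℝ) ≤ I.size := by exact_mod_cast h4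
  linarith

theorem steps_le (N : ℕ) : (I.gridData N).codes * (11 * I.n + 120 * I.bits N ^ 2 + 33) + 9 * I.n + 14
    ≤ 200 * I.bits N ^ 7 := by
  have h4 := six_mul_n_add_four_le_size (I := I)
  have hb : I.size ≤ I.bits N := Nat.le_add_right _ _
  generalize I.bits N = Z at *
  have hn : I.n ≤ Z := by omega
  have hn3 : I.n + 3 ≤ Z := by omega
  have hcodes : (I.gridData N).codes ≤ Z * Z ^ 4 :=
    Nat.mul_le_mul hn (Nat.pow_le_pow_left hn3 4)
  have hZ : 4 ≤ Z := by omega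
  have h1 : 11 * I.n + 120 * Z ^ 2 + 33 ≤ 140 * Z ^ 2 := by nlinarith
  have h2 := Nat.mul_le_mul hcodes h1
  have h3 : Z * 1 ≤ Z * Z ^ 6 := Nat.mul_le_mul_left _ (Nat.one_le_pow _ _ (by omega))
  have h5 : Z * Z ^ 4 * (140 * Z ^ 2) = 140 * Z ^ 7 := by ring
  have h6 : Z * Z ^ 6 = Z ^ 7 := by ring
  omega

end MinCKP

theorem theorem2 :
    ∃ (P : RAM.Prog) (K d : ℕ), ∀ (I : MinCKP) (δ : ℝ), 0 < δ →
      I.C ≤ (∑ i, I.p i) ^ 2 + (∑ i, I.q i) ^ 2 →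
      ∃ (t : ℕ) (σ : RAM.Mem) (x : Fin I.n → ℚ),
        RAM.Exec P (I.input ⌈1 / δ⌉₊) t σ ∧
        I.IsOutput σ x ∧
        I.IsDeltaOptimal δ x ∧
        (t : ℝ) ≤ K * ((I.size : ℝ) + max 0 (Real.log (1 / δ))) ^ d := by
  obtain ⟨W, hW⟩ : ∃ W, W = Search.solveProg.weight := ⟨_, rfl⟩
  refine ⟨Search.solveProg, 120000 * W * 2 ^ 9, 9, fun I δ hδ h => ?_⟩
  have hn := MinCKP.n_pos h
  have hN : 0 < ⌈1 / δ⌉₊ := Nat.ceil_pos.2 (by positivity)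
  obtain ⟨t, σ, hexec, ht, -, hσ⟩ :=
    Search.solveProg_halts (I := I) (N := ⌈1 / δ⌉₊) hn hN le_rfl
  rw [← hW] at ht
  obtain ⟨x, hout, hx⟩ := MinCKP.isDeltaOptimal_of_search hδ (Nat.le_ceil _) h
    (MinCKP.tame_gridData _ hn hN) hσ
  refine ⟨t, σ, x, hexec, hout, hx, ?_⟩
  have h1 : t ≤ 120000 * W * I.bits ⌈1 / δ⌉₊ ^ 9 := by
    refine ht.trans ((Nat.mul_le_mul_right _ (MinCKP.steps_le _)).trans (le_of_eq ?_))
    ring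
  calc (t : ℝ) ≤ 120000 * W * (I.bits ⌈1 / δ⌉₊ : ℝ) ^ 9 := by exact_mod_cast h1
    _ ≤ 120000 * W *
        (2 * ((I.size : ℝ) + max 0 (Real.log (1 / δ)))) ^ 9 :=
      mul_le_mul_of_nonneg_left (pow_le_pow_left₀ (Nat.cast_nonneg _) (MinCKP.bits_le hδ) 9)
        (mul_nonneg (by norm_num) (Nat.cast_nonneg _))
    _ = _ := by
      rw [mul_pow]
      push_cast
      ring
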